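/- Let $R$ be a principal ideal domain and let $f:\{0,\dots,m\}\to R\text{-Mod}$ be a persistence module such that each $f_i$ is free and finitely generated and $f_0=f_m=0$. Then $f$ can be given, after choosing bases, by the matrices $F_i$ of the maps $f(i\le i+1)$, $0\le i<m$. For $0\le b<d\le m$ let $I^{b,d}$ be the interval module with $I^{b,d}_i=R$ for $b\le i<d$ and $0$ otherwise, with identity maps where possible and zero maps elsewhere; an interval decomposition of $f$ is an isomorphism $f\cong\bigoplus_k I^{b_k,d_k}$. Bases $\beta_i$ of $f_i$ give an interval decomposition if every $f(i\le j)$ sends each element of $\beta_i$ to $0$ or to an element of $\beta_j$, the latter in a one-to-one manner. For $0\le a\le j\le m$ put $\mathrm{Ker}[a,j]=\ker f(a\le j)$, and $\mathrm{Ker}[a,j]=0$ for $j<a$. A kernel filtration matrix at $f_a$ is an invertible matrix $X_a=[X_a^{a+1}|\cdots|X_a^m]$ such that the columns of $[X_a^{a+1}|\cdots|X_a^j]$ span $\mathrm{Ker}[a,j]$ for all $j$; $(X_a^j)^{-1}$ denotes the row submatrix of $X_a^{-1}$ belonging to the column block $X_a^j$. A Smith normal form (SNF) factorization of a matrix $A$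 is $SAT=\mathrm{diag}(\alpha_1,\dots,\alpha_r,0,\dots,0)$ with $S,T$ unimodular, $\alpha_k\ne0$ and $\alpha_k\mid\alpha_{k+1}$; $T^+$ consists of the first $r$ columns of $T$ and $T^-$ of the others. Consider the following algorithm. Start with $\beta_i=\emptyset$ for all $i$ and with the empty matrix $Y_0$. For $i=1,\dots,m-1$: 1. Compute a kernel filtration matrix $X_i$ at $f_i$: for $k=i,\dots,m-1$ take an SNF factorization, with right factor $T_k$, of $F_kF_{k-1}\cdots F_iT_i^+\cdots T_{k-1}^+$, and set $X_i^{k+1}=T_i^+\cdots T_{k-1}^+T_k^-$. Compute $X_i^{-1}$ (by means of an SNF factorization). 2. For $j=i+1,\dots,m$ compute an SNF factorization $SAT=D$ of $A=A_i^j:=(X_i^j)^{-1}F_{i-1}Y_{i-1}^j$. If $r$ is the number of columns of $A$ and all $\alpha_k$ are units, let $B_i^j$ consist of the columns of $S^{-1}$ after the first $r$, and set $Y_i^j=[X_i^jB_i^j\,|\,F_{i-1}Y_{i-1}^j]$. Otherwise halt and return $i$, $j$, $X_i$, $Y_{i-1}$, $A$ and its SNF factorization. 3. Let $\beta_i$ be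 the set of columns of $Y_i=[Y_i^{i+1}|\cdots|Y_i^m]$. If the algorithm does not halt in step 2, it returns all the $\beta_i$. **Theorem.** Let matrix multiplication and SNF factorization over $R$ be carried out by any given procedures that return correct results whenever they terminate, and suppose that the algorithm terminates. * If $f$ has an interval decomposition, the algorithm returns bases $\beta_i$ that give an interval decomposition of $f$. * If $f$ has no interval decomposition, the algorithm halts in step 2 and returns a valid certificate, that is, data in which $X_i$ and $Y_{i-1}$ are kernel filtration matrices at $f_i$ and $f_{i-1}$, $i<j\le m$, $A=(X_i^j)^{-1}F_{i-1}Y_{i-1}^j$, and some elementary divisor $\alpha_k$ of $A$ is not a unit. Whenever a valid certificate for $f$ exists, $f$ has no interval decomposition. The algorithm terminates (runs in finite time) if the procedures for multiplication and for SNF factorization terminate on all matrices. If the numbers of steps of these two procedures are bounded by a polynomial in the matrix dimensions, then the number of steps of the algorithm is bounded by a polynomial in $m$ and $d=\max_i\operatorname{rank}f_i$, and this polynomial depends only on the given one; here steps other than those spent in the two procedures are elementary ones (copying a matrix entry, testing whether an element of $R$ is a unit, inverting a unit), each of which counts as one step. -/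

import Mathlib

open CategoryTheory

universe u

/-! ### Persistence modules, interval modules, interval decompositions -/

section Persistence

variable {R : Type u} [CommRing R] {m : ℕ}

/-- The value at `i` of the interval module `I^{b,d}`: it is `R` when `b ≤ i < d`
and `0` otherwise (both realised as submodules of `R`). -/
def intervalSpace (R : Type u) [CommRing R] {m : ℕ} (b d i : Fin (m + 1)) : Submodule R R :=
  open Classical in if b ≤ i ∧ i < d then ⊤ else ⊥

/-- The structure map of `I^{b,d}` from `i` to `j`: the identity of `R` when
`b ≤ i` and `j < d`, and zero otherwise. -/
def intervalMap (R : Type u) [CommRing R] {m : ℕ} (b d : Fin (m + 1)) {i j : Fin (m + 1)}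
    (h : i ≤ j) : intervalSpace R b d i →ₗ[R] intervalSpace R b d j :=
  open Classical in
  if hd : b ≤ i ∧ j < d then
    LinearMap.codRestrict _ (intervalSpace R b d i).subtype (fun x => by
      simp [intervalSpace, hd.1.trans h, hd.2])
  else 0

lemma intervalMap_coe (b d : Fin (m + 1)) {i j : Fin (m + 1)} (h : i ≤ j)
    (x : intervalSpace R b d i) [Decidable (b ≤ i ∧ j < d)] :
    ((intervalMap R b d h x : intervalSpace R b d j) : R)
      = if b ≤ i ∧ j < d then (x : R) else 0 := by
  by_cases hd : b ≤ i ∧ j < d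
  · simp only [intervalMap, hd, and_self, dite_true, if_true]
    rfl
  · simp [intervalMap, hd]

lemma intervalSpace_eq_zero {b d i : Fin (m + 1)} (h : ¬ (b ≤ i ∧ i < d))
    (x : intervalSpace R b d i) : (x : R) = 0 := by
  have := x.2
  simpa [intervalSpace, h] using this

/-- The interval module `I^{b,d}`, as a functor from the poset `{0, …, m}` to `R`-modules. -/
noncomputable def intervalModule (R : Type u) [CommRing R] {m : ℕ} (b d : Fin (m + 1)) :
    Fin (m + 1) ⥤ ModuleCat.{u} R where
  obj i := ModuleCat.of R (intervalSpace R b d i)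
  map φ := ModuleCat.ofHom (intervalMap R b d (leOfHom φ))
  map_id i := by
    classical
    refine ModuleCat.hom_ext (LinearMap.ext fun x => Subtype.ext ?_)
    simp only [ModuleCat.hom_ofHom, ModuleCat.hom_id, LinearMap.id_apply, intervalMap_coe]
    by_cases hi : b ≤ i ∧ i < d
    · simp [hi]
    · simp [hi, intervalSpace_eq_zero hi x]
  map_comp {i j k} φ ψ := by
    classical
    refine ModuleCat.hom_ext (LinearMap.ext fun x => Subtype.ext ?_)
    have h1 := leOfHom φ
    have h2 := leOfHom ψ
    simp only [ModuleCat.hom_ofHom, ModuleCat.hom_comp, LinearMap.comp_apply, intervalMap_coe]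
    by_cases hb : b ≤ i
    · by_cases hk : k < d
      · simp [hb, hk, hb.trans h1, lt_of_le_of_lt h2 hk]
      · simp [hk]
    · simp [hb]

/-- The (pointwise) direct sum of a family of persistence modules. -/
noncomputable def persistenceSum {ι : Type} (g : ι → (Fin (m + 1) ⥤ ModuleCat.{u} R)) :
    Fin (m + 1) ⥤ ModuleCat.{u} R where
  obj i := ModuleCat.of R (DirectSum ι fun k => (g k).obj i)
  map φ := ModuleCat.ofHom (DirectSum.lmap fun k => ((g k).map φ).hom)
  map_id i := by
    classical
    refine ModuleCat.hom_ext (DirectSum.linearMap_ext R fun k => LinearMap.ext fun y => ?_)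
    simp
  map_comp φ ψ := by
    classical
    refine ModuleCat.hom_ext (DirectSum.linearMap_ext R fun k => LinearMap.ext fun y => ?_)
    simp

/-- `f` admits an interval decomposition: `f` is isomorphic to a direct sum of interval modules
`I^{b_k,d_k}` with `0 ≤ b_k < d_k ≤ m`. -/
def HasIntervalDecomposition (f : Fin (m + 1) ⥤ ModuleCat.{u} R) : Prop :=
  ∃ (ι : Type) (b d : ι → Fin (m + 1)), (∀ k, b k < d k) ∧
    Nonempty (f ≅ persistenceSum fun k => intervalModule R (b k) (d k))

/-- An interval decomposition given by bases: each `β i` is a basis of `f_i`, and every structure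
map sends each basis vector of `f_i` either to zero or to a basis vector of `f_j`, the latter in a
one-to-one manner. -/
def IsIntervalBasis (f : Fin (m + 1) ⥤ ModuleCat.{u} R) {ι : Fin (m + 1) → Type}
    (β : ∀ i, ι i → f.obj i) : Prop :=
  (∀ i, LinearIndependent R (β i) ∧ Submodule.span R (Set.range (β i)) = ⊤) ∧
  ∀ (i j : Fin (m + 1)) (h : i ≤ j) (x : ι i),
    f.map (homOfLE h) (β i x) = 0 ∨
    (f.map (homOfLE h) (β i x) ∈ Set.range (β j) ∧
      ∀ y : ι i, f.map (homOfLE h) (β i y) = f.map (homOfLE h) (β i x) → y = x)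

end Persistence

/-! ### Computations with a step count -/

/-- A deterministic computation with result in `α`: `none` if it does not terminate,
`some (a, t)` if it returns `a` after `t` steps. -/
def Timed (α : Type*) := Option (α × ℕ)

namespace Timed

variable {α β : Type*}

/-- Return `a` after `n` elementary steps. -/
def step (n : ℕ) (a : α) : Timed α := some (a, n)

/-- Sequential composition; step counts add up. -/
def bind (x : Timed α) (g : α → Timed β) : Timed β :=
  match x with
  | none => none
  | some (a, s) =>
    match g a with
    | none => none
    | some (b, t) => some (b, s + t)

/-- The computation terminates with result `a`. -/
def Returns (x : Timed α) (a : α) : Prop := ∃ t, x = some (a, t)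

/-- The computation terminates. -/
def Halts (x : Timed α) : Prop := ∃ a, x.Returns a

/-- The computation terminates after at most `n` steps. -/
def HaltsWithin (x : Timed α) (n : ℕ) : Prop := ∃ a t, x = some (a, t) ∧ t ≤ n

end Timed

/-! ### Matrices: Smith normal form, blocks, elementary operations -/

section Matrices

variable {R : Type u} [CommRing R]

/-- A Smith normal form factorization `S A T = diag(α_1, …, α_r, 0, …, 0)` with `S` and `T`
unimodular, nonzero `α_1, …, α_r`, and `α_a ∣ α_b` for `a ≤ b`. -/
structure SmithFactorization {p q : ℕ} (A : Matrix (Fin p) (Fin q) R) where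
  S : Matrix (Fin p) (Fin p) R
  T : Matrix (Fin q) (Fin q) R
  rank : ℕ
  elem : Fin rank → R
  rank_le_rows : rank ≤ p
  rank_le_cols : rank ≤ q
  isUnit_S : IsUnit S
  isUnit_T : IsUnit T
  elem_ne_zero : ∀ a, elem a ≠ 0
  elem_dvd : ∀ a b, a ≤ b → elem a ∣ elem b
  factorization : S * A * T =
    Matrix.of fun (x : Fin p) (y : Fin q) =>
      if h : (x : ℕ) = y ∧ (x : ℕ) < rank then elem ⟨x, h.2⟩ else 0

/-- Procedures that multiply matrices over `R` and that compute Smith normal form factorizations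
over `R`. They may fail to terminate; when they terminate, their results are correct. -/
structure MatrixProcedures (R : Type u) [CommRing R] where
  mul : ∀ {p q r : ℕ} (A : Matrix (Fin p) (Fin q) R) (B : Matrix (Fin q) (Fin r) R),
    Timed {C : Matrix (Fin p) (Fin r) R // C = A * B}
  snf : ∀ {p q : ℕ} (A : Matrix (Fin p) (Fin q) R), Timed (SmithFactorization A)

/-- Matrices over `R` are multiplied and placed in Smith normal form in finite time. -/
def MatrixProcedures.FiniteTime (proc : MatrixProcedures R) : Prop :=
  (∀ (p q r : ℕ) (A : Matrix (Fin p) (Fin q) R) (B : Matrix (Fin q) (Fin r) R),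
    (proc.mul A B).Halts) ∧
  ∀ (p q : ℕ) (A : Matrix (Fin p) (Fin q) R), (proc.snf A).Halts

/-- Matrices over `R` are multiplied and placed in Smith normal form within a number of steps
that is bounded by the polynomial `P` of the matrix dimensions. -/
def MatrixProcedures.TimeBoundedBy (proc : MatrixProcedures R) (P : Polynomial ℕ) : Prop :=
  (∀ (p q r : ℕ) (A : Matrix (Fin p) (Fin q) R) (B : Matrix (Fin q) (Fin r) R),
    (proc.mul A B).HaltsWithin (P.eval (p + q + r))) ∧
  ∀ (p q : ℕ) (A : Matrix (Fin p) (Fin q) R), (proc.snf A).HaltsWithin (P.eval (p + q))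

/-- The submatrix of the first `r` columns. -/
def firstCols {p q : ℕ} (M : Matrix (Fin p) (Fin q) R) {r : ℕ} (h : r ≤ q) :
    Matrix (Fin p) (Fin r) R :=
  Matrix.of fun a c => M a (Fin.castLE h c)

/-- The submatrix of the columns after the first `r`. -/
def lastCols {p q : ℕ} (M : Matrix (Fin p) (Fin q) R) {r : ℕ} (h : r ≤ q) :
    Matrix (Fin p) (Fin (q - r)) R :=
  Matrix.of fun a c => M a ⟨r + c, by omega⟩

/-- A matrix with `n` rows and any number of columns. -/
structure Block (R : Type u) (n : ℕ) where
  width : ℕ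
  mat : Matrix (Fin n) (Fin width) R

/-- A partitioned matrix `[X^0 | X^1 | ⋯ ]` with `n` rows; only the blocks `X^0, …, X^m` are
used for a persistence module of length `m`. -/
abbrev BlockRow (R : Type u) (n : ℕ) := ℕ → Block R n

/-- The partitioned matrix without columns. -/
def BlockRow.empty (R : Type u) (n : ℕ) : BlockRow R n := fun _ => ⟨0, Matrix.of fun _ c => c.elim0⟩

/-- The matrix `[X^0 | ⋯ | X^m]`. -/
def BlockRow.toMatrix {n : ℕ} (X : BlockRow R n) (m : ℕ) :
    Matrix (Fin n) (Fin (∑ j : Fin (m + 1), (X j).width)) R :=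
  Matrix.of fun a c => (X (finSigmaFinEquiv.symm c).1).mat a (finSigmaFinEquiv.symm c).2

/-- The row submatrix of `Z` whose row indices are the column indices of the block `X^j` in
`[X^0 | ⋯ | X^m]`. -/
def BlockRow.rows {n m : ℕ} (X : BlockRow R n)
    (Z : Matrix (Fin (∑ j : Fin (m + 1), (X j).width)) (Fin n) R) (j : Fin (m + 1)) :
    Matrix (Fin (X j).width) (Fin n) R :=
  Matrix.of fun a b => Z (finSigmaFinEquiv ⟨j, a⟩) b

/-- `Z` is a two-sided inverse of `M`. -/
def IsInverseMatrix {p q : ℕ} (M : Matrix (Fin p) (Fin q) R) (Z : Matrix (Fin q) (Fin p) R) :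
    Prop :=
  Z * M = 1 ∧ M * Z = 1

/-- Write down a matrix entry by entry (each entry being a copy of an available ring element, or
the constant `0` or `1`): one step per entry, and one for the call. -/
def writeMatrix {p q : ℕ} (M : Matrix (Fin p) (Fin q) R) : Timed (Matrix (Fin p) (Fin q) R) :=
  Timed.step (p * q + 1) M

/-- Compute the inverses of the elementary divisors (all of which are units whenever this is
called), one step each. -/
noncomputable def invertDivisors {p q : ℕ} {A : Matrix (Fin p) (Fin q) R}
    (fac : SmithFactorization A) : Timed (Fin fac.rank → R) :=
  Timed.step (fac.rank + 1) fun a => Ring.inverse (fac.elem a)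

/-- Invert a unimodular matrix `M`: if `S M T = D` is its Smith normal form factorization then
`M⁻¹ = T D⁻¹ S`. -/
noncomputable def invertMatrix (proc : MatrixProcedures R) {p q : ℕ}
    (M : Matrix (Fin p) (Fin q) R) : Timed (Matrix (Fin q) (Fin p) R) :=
  (proc.snf M).bind fun fac =>
  (invertDivisors fac).bind fun c =>
  (writeMatrix (Matrix.of fun (x : Fin q) (y : Fin p) =>
    if h : (x : ℕ) = y ∧ (x : ℕ) < fac.rank then c ⟨x, h.2⟩ else 0)).bind fun Dinv =>
  (proc.mul fac.T Dinv).bind fun TD =>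
  (proc.mul TD.1 fac.S).bind fun Z =>
  Timed.step 1 Z.1

/-- Test whether a Smith normal form factorization of `A` yields a complement of `A`, that is,
whether the elementary divisors are units (one unit test each) and their number is the number of
columns of `A`. -/
noncomputable def yieldsComplement {p q : ℕ} {A : Matrix (Fin p) (Fin q) R}
    (fac : SmithFactorization A) : Timed Bool :=
  open Classical in
  Timed.step (fac.rank + 1) (decide (fac.rank = q ∧ ∀ a, IsUnit (fac.elem a)))

/-- The complement of `A` that is read off a Smith normal form factorization `S A T = D`: the
columns of `S⁻¹` after the first `r`. -/
noncomputable def computeComplement (proc : MatrixProcedures R) {p q : ℕ}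
    {A : Matrix (Fin p) (Fin q) R} (fac : SmithFactorization A) :
    Timed (Matrix (Fin p) (Fin (p - fac.rank)) R) :=
  (invertMatrix proc fac.S).bind fun Sinv =>
  writeMatrix (lastCols Sinv fac.rank_le_rows)

end Matrices

/-! ### Persistence modules given by matrices -/

/-- The matrix encoding of a persistence module on `{0, …, m}` with values `R^{dim i}` and with
`f_0 = f_m = 0`. The matrix `mat i` represents `f(i ≤ i+1)`. The finite sequence is continued
by zero modules after `m`. -/
structure MatrixModule (R : Type u) (m : ℕ) where
  dim : ℕ → ℕ
  mat : ∀ i : ℕ, Matrix (Fin (dim (i + 1))) (Fin (dim i)) R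
  dim_zero : dim 0 = 0
  dim_of_ge : ∀ i, m ≤ i → dim i = 0

namespace MatrixModule

variable {R : Type u} [CommRing R] {m : ℕ}

/-- `F` is the sequence of matrices of the maps `f(i ≤ i+1)` with respect to the bases `e i`. -/
def Represents (F : MatrixModule R m) (f : Fin (m + 1) ⥤ ModuleCat.{u} R)
    (e : ∀ i : Fin (m + 1), Module.Basis (Fin (F.dim i)) R (f.obj i)) : Prop :=
  ∀ (i : ℕ) (hi : i < m),
    LinearMap.toMatrix (e ⟨i, by omega⟩) (e ⟨i + 1, by omega⟩)
      (f.map (homOfLE (show (⟨i, by omega⟩ : Fin (m + 1)) ≤ ⟨i + 1, by omega⟩ by simp))).hom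
      = F.mat i

/-- The matrix `F_{a+n-1} ⋯ F_a` of `f(a ≤ a+n)`. -/
def trans (F : MatrixModule R m) (a : ℕ) : (n : ℕ) → Matrix (Fin (F.dim (a + n))) (Fin (F.dim a)) R
  | 0 => 1
  | n + 1 => F.mat (a + n) * F.trans a n

/-- `Ker[a,j]`: the kernel of `f(a ≤ j)` if `a ≤ j`, and `0` otherwise. -/
def ker (F : MatrixModule R m) (a j : ℕ) : Submodule R (Fin (F.dim a) → R) :=
  if a ≤ j then LinearMap.ker (F.trans a (j - a)).mulVecLin else ⊥

/-- `X` is a kernel filtration matrix at `f_a`: it is invertible and, for all `j ≤ m`, the columns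
of its blocks up to the `j`-th one span `Ker[a,j]`. (Hence its blocks up to the `a`-th one are
empty.) -/
def IsKernelFiltration (F : MatrixModule R m) (a : ℕ) (X : BlockRow R (F.dim a)) : Prop :=
  (∃ Z, IsInverseMatrix (X.toMatrix m) Z) ∧
  ∀ j ≤ m, Submodule.span R {v | ∃ l ≤ j, ∃ c : Fin (X l).width, v = fun x => (X l).mat x c}
    = F.ker a j

/-! ### The algorithm -/

/-- What the algorithm returns when it stops without an interval decomposition, in its iteration
`(i, j)` with `i = k + 1`: the partitioned matrices `X = X_i` and `Y = Y_{i-1}`, the matrix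
`A = A_i^j`, and a Smith normal form factorization of `A`. -/
structure Certificate (F : MatrixModule R m) where
  k : ℕ
  j : Fin (m + 1)
  X : BlockRow R (F.dim (k + 1))
  Y : BlockRow R (F.dim k)
  A : Matrix (Fin (X j).width) (Fin (Y j).width) R
  fac : SmithFactorization A

/-- The certificate is genuine: `X` and `Y` are kernel filtration matrices at `f_i` and `f_{i-1}`,
`A = (X^j)⁻¹ F_{i-1} Y^j`, where `(X^j)⁻¹` is the row submatrix of `X⁻¹` that belongs to `X^j`,
and the matrix `A` has an elementary divisor that is not a unit. -/
def Certificate.Valid {F : MatrixModule R m} (c : F.Certificate) : Prop :=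
  c.k + 1 < m ∧ c.k + 1 < (c.j : ℕ) ∧
  F.IsKernelFiltration (c.k + 1) c.X ∧ F.IsKernelFiltration c.k c.Y ∧
  (∃ Z, IsInverseMatrix (c.X.toMatrix m) Z ∧
    c.A = c.X.rows Z c.j * F.mat c.k * (c.Y c.j).mat) ∧
  ∃ a, ¬ IsUnit (c.fac.elem a)

/-- The result of the algorithm: a partitioned matrix `Y_i` for each `i`, the columns of which form
`β_i`, or a certificate that no interval decomposition exists. -/
inductive Output (F : MatrixModule R m) where
  | bases (Y : ∀ i : ℕ, BlockRow R (F.dim i))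
  | halt (c : F.Certificate)

/-- `n` further steps `k, k+1, …, k+n-1` of the computation of a kernel filtration matrix at `f_a`.
In step `k`, `P` is `T_a⁺ ⋯ T_{k-1}⁺` and `G` is `F_{k-1} ⋯ F_a T_a⁺ ⋯ T_{k-1}⁺`; a Smith normal
form factorization of `F_k G` with right factor `T_k` is computed, and the block with index `k+1`
is set to `P T_k⁻`. -/
def kernelLoop (proc : MatrixProcedures R) (F : MatrixModule R m) (a : ℕ) :
    (n k : ℕ) → (r : ℕ) → Matrix (Fin (F.dim a)) (Fin r) R → Matrix (Fin (F.dim k)) (Fin r) R →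
      BlockRow R (F.dim a) → Timed (BlockRow R (F.dim a))
  | 0, _, _, _, _, X => Timed.step 1 X
  | n + 1, k, _, P, G, X =>
    (proc.mul (F.mat k) G).bind fun H =>
    (proc.snf H.1).bind fun fac =>
    (writeMatrix (firstCols fac.T fac.rank_le_cols)).bind fun Tpos =>
    (writeMatrix (lastCols fac.T fac.rank_le_cols)).bind fun Tneg =>
    (proc.mul P Tneg).bind fun block =>
    (proc.mul P Tpos).bind fun P' =>
    (proc.mul H.1 Tpos).bind fun G' =>
    kernelLoop proc F a n (k + 1) fac.rank P'.1 G'.1 (Function.update X (k + 1) ⟨_, block.1⟩)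

/-- Compute a kernel filtration matrix at `f_a` by repeated Smith normal form factorization. -/
def kernelFiltration (proc : MatrixProcedures R) (F : MatrixModule R m) (a : ℕ) :
    Timed (BlockRow R (F.dim a)) :=
  (writeMatrix (1 : Matrix (Fin (F.dim a)) (Fin (F.dim a)) R)).bind fun I =>
  kernelLoop proc F a (m - a) a (F.dim a) I I (BlockRow.empty R (F.dim a))

/-- The inner loop, over a list of indices `j`, for `i = k + 1`. Here `X = X_i`, `Z = X_i⁻¹`,
`Y = Y_{i-1}`, and the blocks `Y_i^j = [X_i^j B_i^j | F_{i-1} Y_{i-1}^j]` are collected in the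
last argument. -/
noncomputable def innerLoop (proc : MatrixProcedures R) (F : MatrixModule R m) (k : ℕ)
    (X : BlockRow R (F.dim (k + 1)))
    (Z : Matrix (Fin (∑ j : Fin (m + 1), (X j).width)) (Fin (F.dim (k + 1))) R)
    (Y : BlockRow R (F.dim k)) :
    List (Fin (m + 1)) → BlockRow R (F.dim (k + 1)) →
      Timed (F.Certificate ⊕ BlockRow R (F.dim (k + 1)))
  | [], Ynew => Timed.step 1 (Sum.inr Ynew)
  | j :: js, Ynew =>
    (writeMatrix (X.rows Z j)).bind fun W =>
    (proc.mul (F.mat k) (Y j).mat).bind fun FY =>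
    (proc.mul W FY.1).bind fun A =>
    (proc.snf A.1).bind fun fac =>
    (yieldsComplement fac).bind fun ok =>
    if ok then
      (computeComplement proc fac).bind fun B =>
      (proc.mul (X j).mat B).bind fun XB =>
      (writeMatrix (Matrix.of fun x => Fin.append (XB.1 x) (FY.1 x))).bind fun block =>
      innerLoop proc F k X Z Y js (Function.update Ynew (j : ℕ) ⟨_, block⟩)
    else
      Timed.step 1 (Sum.inl ⟨k, j, X, Y, A.1, fac⟩)

/-- `n` further iterations `i = k+1, …, k+n` of the outer loop. Here `Y` is `Y_k`, and `β` holds the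
partitioned matrices that are found so far. -/
noncomputable def outerLoop (proc : MatrixProcedures R) (F : MatrixModule R m) :
    (n k : ℕ) → BlockRow R (F.dim k) → (∀ i : ℕ, BlockRow R (F.dim i)) → Timed F.Output
  | 0, _, _, β => Timed.step 1 (Output.bases β)
  | n + 1, k, Y, β =>
    (kernelFiltration proc F (k + 1)).bind fun X =>
    (writeMatrix (X.toMatrix m)).bind fun M =>
    (invertMatrix proc M).bind fun Z =>
    (innerLoop proc F k X Z Y ((List.finRange (m + 1)).filter fun j => k + 1 < (j : ℕ))
      (BlockRow.empty R (F.dim (k + 1)))).bind fun res =>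
    match res with
    | Sum.inl c => Timed.step 1 (Output.halt c)
    | Sum.inr Ynew => outerLoop proc F n (k + 1) Ynew (Function.update β (k + 1) Ynew)

/-- The matrix algorithm: start with empty `β_i` and the trivial kernel filtration matrix at
`f_0 = 0`, and run the outer loop for `i = 1, …, m - 1`. -/
noncomputable def algorithm (proc : MatrixProcedures R) (F : MatrixModule R m) : Timed F.Output :=
  outerLoop proc F (m - 1) 0 (BlockRow.empty R (F.dim 0)) fun i => BlockRow.empty R (F.dim i)

/-- The vectors of `f_i` whose coordinates with respect to `e i` are the columns of
`[Y_i^0 | ⋯ | Y_i^m]`. -/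
noncomputable def columnVectors (F : MatrixModule R m) {f : Fin (m + 1) ⥤ ModuleCat.{u} R}
    (e : ∀ i : Fin (m + 1), Module.Basis (Fin (F.dim i)) R (f.obj i))
    (Y : ∀ i : ℕ, BlockRow R (F.dim i)) (i : Fin (m + 1)) :
    (Σ j : Fin (m + 1), Fin (Y i j).width) → f.obj i :=
  fun s => ∑ a, (Y i s.1).mat a s.2 • e i a

end MatrixModule

/-! ### Termination and step counts -/

namespace Timed

variable {α β : Type*}

/-! Let j > i. For l ≥ i a vector v of f_{i-1} lies in Ker[i-1,l] exactly when its image in f_i lies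
in Ker[i,l] (`mem_ker_succ`). Taking l = j and l = j-1, the structure map induces an injection from
Ker[i-1,j]/Ker[i-1,j-1] to Ker[i,j]/Ker[i,j-1]. A kernel filtration matrix amounts to bases of all
these quotients (`isKernelFiltration_iff`), and in such bases the injection is the matrix A_i^j
(`mat_mulVec_sub_mem`).

If its elementary divisors are units, the columns of A_i^j are completed to a basis by the columns
of B, so X_i^j B and F_{i-1} Y_{i-1}^j together represent a basis of the target quotient
(`isBasisModulo_append`). Hence Y_i is again a kernel filtration matrix. Columns of Y_{i-1} in
blocks j > i go to columns of Y_i, all others to zero. A run that reaches the end therefore gives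
interval bases (`IsPartialSolution.isIntervalBasis`), and these split f into intervals
(`IsIntervalBasis.hasIntervalDecomposition`).

If some divisor α is not a unit, there is x in Ker[i,j] outside Ker[i,j-1] + f(Ker[i-1,j]) such that
αx lies in this sum. In a sum of interval modules this submodule is saturated
(`HasIntervalDecomposition.exists_eq_add`), so f is not such a sum. Each output thus proves the case
it claims.

For the running time, the loops have O(m) rounds and nest to depth two. A round costs boundedly many
operations besides its inner loops, all on matrices with sides at most (m+1)d. -/

lemma returns_step {n : ℕ} {a b : α} : (step n a).Returns b ↔ b = a := by
  constructor
  · rintro ⟨t, ht⟩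
    exact (congrArg Prod.fst (Option.some.inj ht)).symm
  · rintro rfl
    exact ⟨n, rfl⟩

lemma returns_bind {x : Timed α} {g : α → Timed β} {b : β} :
    (x.bind g).Returns b ↔ ∃ a, x.Returns a ∧ (g a).Returns b := by
  constructor
  · rintro ⟨t, ht⟩
    rcases x with _ | ⟨a, s⟩
    · exact absurd ht (by simp [bind])
    · rcases hg : g a with _ | ⟨b', t'⟩
      · simp [bind, hg] at ht
      · simp only [bind, hg] at ht
        obtain rfl : b' = b := congrArg Prod.fst (Option.some.inj ht)
        exact ⟨a, ⟨s, rfl⟩, t', hg⟩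
  · rintro ⟨a, ⟨s, rfl⟩, t, ht⟩
    exact ⟨s + t, by simp only [bind, ht]; rfl⟩

lemma halts_step (n : ℕ) (a : α) : (step n a).Halts := ⟨a, n, rfl⟩

lemma Halts.bind {x : Timed α} {g : α → Timed β} (hx : x.Halts)
    (hg : ∀ a, (g a).Halts) : (x.bind g).Halts := by
  obtain ⟨a, ha⟩ := hx
  obtain ⟨b, hb⟩ := hg a
  exact ⟨b, returns_bind.2 ⟨a, ha, hb⟩⟩

/-- The computation terminates after at most `n` steps, with a result that satisfies `P`. -/
def HaltsWithinWith (x : Timed α) (n : ℕ) (P : α → Prop) : Prop :=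
  ∃ a t, x = some (a, t) ∧ t ≤ n ∧ P a

lemma HaltsWithinWith.haltsWithin {x : Timed α} {n : ℕ} {P : α → Prop}
    (h : x.HaltsWithinWith n P) : x.HaltsWithin n := by
  obtain ⟨a, t, h1, h2, -⟩ := h
  exact ⟨a, t, h1, h2⟩

lemma HaltsWithin.with_true {x : Timed α} {n : ℕ} (h : x.HaltsWithin n) :
    x.HaltsWithinWith n fun _ => True := by
  obtain ⟨a, t, h1, h2⟩ := h
  exact ⟨a, t, h1, h2, trivial⟩

lemma haltsWithinWith_step {n s : ℕ} {a : α} {P : α → Prop} (h : s ≤ n) (ha : P a) :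
    (step s a).HaltsWithinWith n P := ⟨a, s, rfl, h, ha⟩

lemma HaltsWithinWith.mono {x : Timed α} {n n' : ℕ} {P P' : α → Prop}
    (h : x.HaltsWithinWith n P) (hn : n ≤ n') (hP : ∀ a, P a → P' a) :
    x.HaltsWithinWith n' P' := by
  obtain ⟨a, t, h1, h2, h3⟩ := h
  exact ⟨a, t, h1, h2.trans hn, hP a h3⟩

lemma HaltsWithinWith.bind {x : Timed α} {g : α → Timed β} {s t : ℕ} {P : α → Prop}
    {Q : β → Prop} (hx : x.HaltsWithinWith s P) (hg : ∀ a, P a → (g a).HaltsWithinWith t Q) :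
    (x.bind g).HaltsWithinWith (s + t) Q := by
  obtain ⟨a, s', rfl, hs, ha⟩ := hx
  obtain ⟨b, t', hb, ht, hQ⟩ := hg a ha
  exact ⟨b, s' + t', by simp only [Timed.bind, hb]; rfl, add_le_add hs ht, hQ⟩

/-- A computation that consists of a step of cost at most `C` and a rest of cost at most `n C`. -/
lemma HaltsWithinWith.bind_mul {x : Timed α} {g : α → Timed β} {C n : ℕ} {P : α → Prop}
    {Q : β → Prop} (hx : x.HaltsWithinWith C P)
    (hg : ∀ a, P a → (g a).HaltsWithinWith (n * C) Q) :
    (x.bind g).HaltsWithinWith ((n + 1) * C) Q :=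
  (hx.bind hg).mono (by rw [add_mul, one_mul, add_comm]) fun _ h => h

end Timed

/-! ### Termination and step counts of the loops -/

section Halting

variable {R : Type u} [CommRing R]

namespace MatrixProcedures.FiniteTime

variable {proc : MatrixProcedures R}

lemma invertMatrix (h : proc.FiniteTime) {p q : ℕ} (M : Matrix (Fin p) (Fin q) R) :
    (invertMatrix proc M).Halts :=
  (h.2 _ _ _).bind fun _ => (Timed.halts_step _ _).bind fun _ => (Timed.halts_step _ _).bind
    fun _ => (h.1 _ _ _ _ _).bind fun _ => (h.1 _ _ _ _ _).bind fun _ => Timed.halts_step _ _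

lemma computeComplement (h : proc.FiniteTime) {p q : ℕ} {A : Matrix (Fin p) (Fin q) R}
    (fac : SmithFactorization A) : (computeComplement proc fac).Halts :=
  (h.invertMatrix _).bind fun _ => Timed.halts_step _ _

variable {m : ℕ} {F : MatrixModule R m}

lemma kernelLoop (h : proc.FiniteTime) (a : ℕ) :
    ∀ (n k r : ℕ) (P : Matrix (Fin (F.dim a)) (Fin r) R) (G : Matrix (Fin (F.dim k)) (Fin r) R)
      (X : BlockRow R (F.dim a)), (MatrixModule.kernelLoop proc F a n k r P G X).Halts
  | 0, _, _, _, _, _ => Timed.halts_step _ _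
  | _ + 1, _, _, _, _, _ =>
    (h.1 _ _ _ _ _).bind fun _ => (h.2 _ _ _).bind fun _ => (Timed.halts_step _ _).bind fun _ =>
    (Timed.halts_step _ _).bind fun _ => (h.1 _ _ _ _ _).bind fun _ => (h.1 _ _ _ _ _).bind
    fun _ => (h.1 _ _ _ _ _).bind fun _ => h.kernelLoop a _ _ _ _ _ _

lemma innerLoop (h : proc.FiniteTime) (k : ℕ) (X : BlockRow R (F.dim (k + 1)))
    (Z : Matrix (Fin (∑ j : Fin (m + 1), (X j).width)) (Fin (F.dim (k + 1))) R)
    (Y : BlockRow R (F.dim k)) : ∀ (js : List (Fin (m + 1))) (Ynew : BlockRow R (F.dim (k + 1))),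
      (MatrixModule.innerLoop proc F k X Z Y js Ynew).Halts
  | [], _ => Timed.halts_step _ _
  | _ :: js, _ => by
    refine (Timed.halts_step _ _).bind fun _ => (h.1 _ _ _ _ _).bind fun _ =>
      (h.1 _ _ _ _ _).bind fun _ => (h.2 _ _ _).bind fun _ => (Timed.halts_step _ _).bind
      fun ok => ?_
    cases ok
    · exact Timed.halts_step _ _
    · exact (h.computeComplement _).bind fun _ => (h.1 _ _ _ _ _).bind fun _ =>
        (Timed.halts_step _ _).bind fun _ => h.innerLoop k X Z Y js _

lemma outerLoop (h : proc.FiniteTime) :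
    ∀ (n k : ℕ) (Y : BlockRow R (F.dim k)) (β : ∀ i : ℕ, BlockRow R (F.dim i)),
      (MatrixModule.outerLoop proc F n k Y β).Halts
  | 0, _, _, _ => Timed.halts_step _ _
  | n + 1, k, Y, β => by
    refine ((Timed.halts_step _ _).bind fun _ => h.kernelLoop _ _ _ _ _ _ _).bind fun _ =>
      (Timed.halts_step _ _).bind fun _ => (h.invertMatrix _).bind fun _ =>
      (h.innerLoop _ _ _ _ _ _).bind fun res => ?_
    cases res
    · exact Timed.halts_step _ _
    · exact h.outerLoop n _ _ _

end MatrixProcedures.FiniteTime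

/-- Every elementary operation on matrices with at most `D` rows and columns takes at most `C`
steps. -/
structure MatrixProcedures.CostBound (proc : MatrixProcedures R) (D C : ℕ) : Prop where
  mul : ∀ {p q r : ℕ} (A : Matrix (Fin p) (Fin q) R) (B : Matrix (Fin q) (Fin r) R),
    p ≤ D → q ≤ D → r ≤ D → (proc.mul A B).HaltsWithinWith C fun _ => True
  snf : ∀ {p q : ℕ} (A : Matrix (Fin p) (Fin q) R), p ≤ D → q ≤ D →
    (proc.snf A).HaltsWithinWith C fun _ => True
  sq_le : D * D + 1 ≤ C

lemma Polynomial.eval_nat_mono (P : Polynomial ℕ) {a b : ℕ} (h : a ≤ b) : P.eval a ≤ P.eval b := by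
  rw [Polynomial.eval_eq_sum_range, Polynomial.eval_eq_sum_range]
  gcongr

/-- A product involves three dimensions of size at most `D`, whence the argument `3 * D`. The
summand `D * D + 1` pays for writing a matrix, and also for at most `D` unit tests or inversions. -/
lemma MatrixProcedures.TimeBoundedBy.costBound {proc : MatrixProcedures R} {P : Polynomial ℕ}
    (h : proc.TimeBoundedBy P) (D : ℕ) : proc.CostBound D (P.eval (3 * D) + D * D + 1) where
  mul {p q r} A B hp hq hr := (h.1 _ _ _ A B).with_true.mono
    (by have := P.eval_nat_mono (show p + q + r ≤ 3 * D by omega); omega) fun _ h => h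
  snf {p q} A hp hq := (h.2 _ _ A).with_true.mono
    (by have := P.eval_nat_mono (show p + q ≤ 3 * D by omega); omega) fun _ h => h
  sq_le := by omega

namespace MatrixProcedures.CostBound

variable {proc : MatrixProcedures R} {D C : ℕ}

lemma one_le (h : proc.CostBound D C) : 1 ≤ C := le_trans (by omega) h.sq_le

lemma succ_le (h : proc.CostBound D C) {r : ℕ} (hr : r ≤ D) : r + 1 ≤ C := by
  have := h.sq_le
  nlinarith

lemma step_one {α : Type*} (h : proc.CostBound D C) {Q : α → Prop} {a : α} (ha : Q a) :
    (Timed.step 1 a).HaltsWithinWith (1 * C) Q :=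
  Timed.haltsWithinWith_step (by have := h.one_le; omega) ha

lemma writeMatrix (h : proc.CostBound D C) {p q : ℕ} (M : Matrix (Fin p) (Fin q) R)
    (hp : p ≤ D) (hq : q ≤ D) : (writeMatrix M).HaltsWithinWith C fun _ => True :=
  Timed.haltsWithinWith_step (le_trans (by gcongr) h.sq_le) trivial

lemma invertMatrix (h : proc.CostBound D C) {p q : ℕ} (M : Matrix (Fin p) (Fin q) R)
    (hp : p ≤ D) (hq : q ≤ D) : (invertMatrix proc M).HaltsWithinWith (6 * C) fun _ => True := by
  refine (h.snf _ hp hq).bind_mul fun fac _ => Timed.HaltsWithinWith.bind_mul (P := fun _ => True)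
    (Timed.haltsWithinWith_step (h.succ_le (fac.rank_le_rows.trans hp)) trivial) fun _ _ =>
    (h.writeMatrix _ hq hp).bind_mul fun _ _ => (h.mul _ _ hq hq hp).bind_mul fun _ _ =>
    (h.mul _ _ hq hp hp).bind_mul fun _ _ => h.step_one trivial

lemma computeComplement (h : proc.CostBound D C) {p q : ℕ} {A : Matrix (Fin p) (Fin q) R}
    (fac : SmithFactorization A) (hp : p ≤ D) :
    (computeComplement proc fac).HaltsWithinWith (7 * C) fun _ => True :=
  ((h.invertMatrix _ hp hp).bind fun _ _ => h.writeMatrix _ hp (by omega)).mono (by omega)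
    fun _ h => h

variable {m : ℕ} {F : MatrixModule R m} {d : ℕ}

/-- A round consists of four products, one factorization and two copies, and the final return costs
one more. The width `r` never grows, since it is replaced by a rank, and a new block has `r -
fac.rank` columns. -/
lemma kernelLoop (h : proc.CostBound D C) (hd : ∀ i, F.dim i ≤ d) (hD : d ≤ D) (a : ℕ) :
    ∀ (n k r : ℕ) (P : Matrix (Fin (F.dim a)) (Fin r) R) (G : Matrix (Fin (F.dim k)) (Fin r) R)
      (X : BlockRow R (F.dim a)), r ≤ d → (∀ j, (X j).width ≤ d) →
      (MatrixModule.kernelLoop proc F a n k r P G X).HaltsWithinWith ((7 * n + 1) * C)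
        fun X => ∀ j, (X j).width ≤ d
  | 0, _, _, _, _, _, _, hX => h.step_one hX
  | n + 1, k, r, P, G, X, hr, hX => by
    have hdD : ∀ i, F.dim i ≤ D := fun i => (hd i).trans hD
    have hrD := hr.trans hD
    refine (h.mul (F.mat k) G (hdD _) (hdD _) hrD).bind_mul fun H _ =>
      (h.snf H.1 (hdD _) hrD).bind_mul fun fac _ => ?_
    have hf := fac.rank_le_cols
    refine (h.writeMatrix _ hrD (by omega)).bind_mul fun Tpos _ =>
      (h.writeMatrix _ hrD (by omega)).bind_mul fun Tneg _ =>
      (h.mul P Tneg (hdD _) hrD (by omega)).bind_mul fun block _ =>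
      (h.mul P Tpos (hdD _) hrD (by omega)).bind_mul fun P' _ =>
      (h.mul H.1 Tpos (hdD _) hrD (by omega)).bind_mul fun G' _ =>
      h.kernelLoop hd hD a n (k + 1) fac.rank P'.1 G'.1 _ (by omega) fun j => ?_
    rcases eq_or_ne j (k + 1) with rfl | hj
    · rw [Function.update_self]
      change r - fac.rank ≤ d
      omega
    · rw [Function.update_of_ne hj]
      exact hX j

/-- A round has five operations up to the test, seven for the complement, a product and a copy. The
bound on the widths is carried along because the result enters the next outer round as `Y`. -/
lemma innerLoop (h : proc.CostBound D C) (hd : ∀ i, F.dim i ≤ d) (hD : d ≤ D) (k : ℕ)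
    (X : BlockRow R (F.dim (k + 1))) (hX : ∀ j, (X j).width ≤ d)
    (Z : Matrix (Fin (∑ j : Fin (m + 1), (X j).width)) (Fin (F.dim (k + 1))) R)
    (Y : BlockRow R (F.dim k)) (hY : ∀ j, (Y j).width ≤ d) :
    ∀ (js : List (Fin (m + 1))) (Ynew : BlockRow R (F.dim (k + 1))), (∀ j, (Ynew j).width ≤ d) →
      (MatrixModule.innerLoop proc F k X Z Y js Ynew).HaltsWithinWith ((14 * js.length + 1) * C)
        fun res => ∀ Y', res = Sum.inr Y' → ∀ j, (Y' j).width ≤ d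
  | [], _, hn => h.step_one fun Y' hY' => by
      rw [← Sum.inr_injective hY']
      exact hn
  | j :: js, Ynew, hn => by
    have hdD : ∀ i, F.dim i ≤ D := fun i => (hd i).trans hD
    have hXD := (hX j).trans hD
    have hYD := (hY j).trans hD
    rw [List.length_cons]
    refine ((h.writeMatrix _ hXD (hdD _)).bind_mul (n := 14 * js.length + 14) fun W _ =>
      (h.mul _ _ (hdD _) (hdD _) hYD).bind_mul (n := 14 * js.length + 13) fun FY _ =>
      (h.mul W FY.1 hXD (hdD _) hYD).bind_mul (n := 14 * js.length + 12) fun A _ =>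
      (h.snf A.1 hXD hYD).bind_mul (n := 14 * js.length + 11) fun fac _ => ?_).mono
        (by ring_nf; exact le_rfl) fun _ h => h
    have hr := fac.rank_le_rows
    refine Timed.HaltsWithinWith.bind_mul (n := 14 * js.length + 10) 
      (P := fun ok => ok = true → fac.rank = (Y j).width)
      (Timed.haltsWithinWith_step (h.succ_le (by omega)) fun hok => by
        classical exact (of_decide_eq_true hok).1)
      fun ok hok => ?_
    cases ok
    · refine (Timed.haltsWithinWith_step (n := C) h.one_le ?_).mono
        (Nat.le_mul_of_pos_left _ (by omega)) fun _ h => h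
      simp
    · have hq := hok rfl
      refine ((h.computeComplement fac hXD).bind fun B _ =>
        (h.mul (X j).mat B (hdD _) hXD (by omega)).bind_mul (n := 14 * js.length + 2)
        fun XB _ => (h.writeMatrix _ (hdD _) ?_).bind_mul fun block _ =>
          h.innerLoop hd hD k X hX Z Y hY js _ fun l => ?_).mono (by ring_nf; exact le_rfl)
        fun _ h => h
      · have := hY j
        omega
      · rcases eq_or_ne l j with rfl | hl
        · rw [Function.update_self]
          -- A passed test gives `fac.rank = (Y j).width`, so the new block has exactly as many
          -- columns as `X j` and widths do not accumulate over the outer rounds.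
          change (X j).width - fac.rank + (Y j).width ≤ d
          have := hX j
          omega
        · rw [Function.update_of_ne hl]
          exact hn l

/-- The coefficient adds up `7 * m + 2` for the filtration, `1 + 6` for assembling and inverting it,
`14 * (m + 1) + 1` for the inner loop, and one to spare. The assembled matrix is bounded crudely by
`m + 1` blocks of width at most `d`, so the count does not depend on the correctness of the
filtration. -/
lemma outerLoop (h : proc.CostBound D C) (hd : ∀ i, F.dim i ≤ d) (hD : (m + 1) * d ≤ D) :
    ∀ (n k : ℕ) (Y : BlockRow R (F.dim k)) (β : ∀ i : ℕ, BlockRow R (F.dim i)),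
      (∀ j, (Y j).width ≤ d) →
      (MatrixModule.outerLoop proc F n k Y β).HaltsWithinWith (((21 * m + 25) * n + 1) * C)
        fun _ => True
  | 0, _, _, _, _ => by
    rw [mul_zero, zero_add]
    exact h.step_one trivial
  | n + 1, k, Y, β, hY => by
    have hdD : d ≤ D := (Nat.le_mul_of_pos_left _ (by omega)).trans hD
    have hdim : ∀ i, F.dim i ≤ D := fun i => (hd i).trans hdD
    have hker : (MatrixModule.kernelFiltration proc F (k + 1)).HaltsWithinWith
        ((7 * m + 2) * C) fun X => ∀ j, (X j).width ≤ d :=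
      ((h.writeMatrix _ (hdim _) (hdim _)).bind_mul fun I _ =>
        h.kernelLoop hd hdD (k + 1) _ _ _ _ _ _ (hd _) fun j => Nat.zero_le _).mono
        (Nat.mul_le_mul_right _ (by omega)) fun _ h => h
    refine (hker.bind (t := ((21 * m + 25) * n + 14 * m + 24) * C) fun X hX => ?_).mono
      (by ring_nf; exact le_rfl) fun _ h => h
    have hw : (∑ j : Fin (m + 1), (X j).width) ≤ D := by
      refine le_trans ?_ hD
      calc (∑ j : Fin (m + 1), (X j).width) ≤ ∑ j : Fin (m + 1), d :=
            Finset.sum_le_sum fun j _ => hX j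
        _ = (m + 1) * d := by simp
    have hlen : ((List.finRange (m + 1)).filter fun j : Fin (m + 1) => k + 1 < (j : ℕ)).length
        ≤ m + 1 :=
      (List.length_filter_le _ _).trans (by simp)
    refine ((h.writeMatrix _ (hdim _) hw).bind fun M _ =>
      (h.invertMatrix M (hdim _) hw).bind fun Z _ =>
      ((h.innerLoop hd hdD k X hX Z Y hY _ _ fun j => Nat.zero_le _).mono
        (n' := (14 * (m + 1) + 1) * C)
        (by gcongr) fun _ h => h).bind
      (t := ((21 * m + 25) * n + 1 + 1) * C) (Q := fun _ => True) fun res hres => ?_).mono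
      (le_of_eq (by ring)) fun _ h => h
    rcases res with c | Ynew
    · exact (Timed.haltsWithinWith_step (n := C) h.one_le trivial).mono
        (Nat.le_mul_of_pos_left _ (by omega)) fun _ h => h
    · exact (h.outerLoop hd hD n (k + 1) Ynew _ (hres _ rfl)).mono
        (Nat.mul_le_mul_right _ (by omega)) fun _ h => h

end MatrixProcedures.CostBound

/-- The algorithm runs in polynomial time if the matrix procedures do. -/
lemma MatrixModule.algorithm_haltsWithin (P : Polynomial ℕ) : ∃ Q : Polynomial ℕ,
    ∀ proc : MatrixProcedures R, proc.TimeBoundedBy P → ∀ (m d : ℕ) (F : MatrixModule R m),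
      (∀ i, F.dim i ≤ d) → (MatrixModule.algorithm proc F).HaltsWithin (Q.eval (m + d)) := by
  -- Evaluated at `m + d`, this dominates `(m + 1) * d`, the largest side of any matrix that occurs.
  let D : Polynomial ℕ := (Polynomial.X + 1) * Polynomial.X
  refine ⟨((21 * Polynomial.X + 25) * Polynomial.X + 1) * (P.comp (3 * D) + D * D + 1),
    fun proc h m d F hd => ?_⟩
  have hD : (m + 1) * d ≤ D.eval (m + d) := by
    simp only [D, Polynomial.eval_mul, Polynomial.eval_add, Polynomial.eval_X, Polynomial.eval_one]
    gcongr <;> omega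
  refine ((MatrixProcedures.CostBound.outerLoop (h.costBound (D.eval (m + d))) hd hD (m - 1) 0 _ _
    fun j => Nat.zero_le _).mono ?_ fun _ h => h).haltsWithin
  simp only [Polynomial.eval_mul, Polynomial.eval_add, Polynomial.eval_X, Polynomial.eval_one,
    Polynomial.eval_comp, Polynomial.eval_ofNat]
  gcongr <;> omega

end Halting

/-! ### Bases adapted to a filtration, and the filtration by kernels -/

section GradedBasis

variable {R : Type u} [CommRing R] {n m : ℕ}

open Matrix

/-- The columns of the block represent a basis of `K` modulo `K'`. -/
structure Block.IsBasisModulo (K K' : Submodule R (Fin n → R)) (B : Block R n) : Prop where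
  mem : ∀ c, B.mat *ᵥ c ∈ K
  exists_sub_mem : ∀ x ∈ K, ∃ c, x - B.mat *ᵥ c ∈ K'
  eq_zero : ∀ c, B.mat *ᵥ c ∈ K' → c = 0

/-- The columns of the block `X^j` represent a basis of `K_j` modulo `K_{j-1}`, for all `j ≤ m`. -/
def BlockRow.IsGradedBasis (K : ℕ → Submodule R (Fin n → R)) (m : ℕ) (X : BlockRow R n) : Prop :=
  ∀ j ≤ m, (X j).IsBasisModulo (K j) (K (j - 1))

namespace BlockRow

variable {X : BlockRow R n} {K : ℕ → Submodule R (Fin n → R)}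

/-- The submodule spanned by the columns of the blocks up to the `j`-th one. -/
abbrev spanUpTo (X : BlockRow R n) (j : ℕ) : Submodule R (Fin n → R) :=
  Submodule.span R {v | ∃ l ≤ j, ∃ c : Fin (X l).width, v = fun x => (X l).mat x c}

lemma mulVec_mem_spanUpTo {l j : ℕ} (h : l ≤ j) (c : Fin (X l).width → R) :
    (X l).mat *ᵥ c ∈ X.spanUpTo j := by
  rw [Matrix.mulVec_eq_sum]
  exact Submodule.sum_mem _ fun i _ => by
    rw [op_smul_eq_smul]
    exact Submodule.smul_mem _ _ (Submodule.subset_span ⟨l, h, i, rfl⟩)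

/-- The indexing of the columns of `[X^0 | ⋯ | X^m]` by blocks. -/
def colEquiv {R : Type u} {n : ℕ} (X : BlockRow R n) (m : ℕ) :
    (Σ j : Fin (m + 1), Fin (X j).width) ≃ Fin (∑ j : Fin (m + 1), (X j).width) :=
  finSigmaFinEquiv

lemma toMatrix_apply {R : Type u} {n : ℕ} (X : BlockRow R n) (m : ℕ) (x : Fin n)
    (s : Σ j : Fin (m + 1), Fin (X j).width) :
    X.toMatrix m x (X.colEquiv m s) = (X s.1).mat x s.2 :=
  congrArg (fun s : Σ j : Fin (m + 1), Fin (X j).width => (X s.1).mat x s.2)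
    ((X.colEquiv m).symm_apply_apply s)

/-- The coefficients of the block `X^j` in a vector of coefficients for `[X^0 | ⋯ | X^m]`. -/
def coeffs (X : BlockRow R n) (m : ℕ) (c : Fin (∑ j : Fin (m + 1), (X j).width) → R) (j : ℕ)
    (a : Fin (X j).width) : R :=
  if h : j < m + 1 then c (X.colEquiv m ⟨⟨j, h⟩, a⟩) else 0

lemma toMatrix_mulVec (X : BlockRow R n) (m : ℕ)
    (c : Fin (∑ j : Fin (m + 1), (X j).width) → R) :
    X.toMatrix m *ᵥ c = ∑ j ∈ Finset.range (m + 1), (X j).mat *ᵥ X.coeffs m c j := by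
  rw [Finset.sum_range]
  ext x
  rw [Finset.sum_apply, Matrix.mulVec, dotProduct, ← (X.colEquiv m).sum_comp,
    Fintype.sum_sigma]
  refine Finset.sum_congr rfl fun j _ => ?_
  rw [Matrix.mulVec, dotProduct]
  refine Finset.sum_congr rfl fun a _ => ?_
  rw [toMatrix_apply, coeffs, dif_pos j.2]

/-- Coefficients for `[X^0 | ⋯ | X^m]` assembled from coefficients for the blocks. -/
def assemble (X : BlockRow R n) (m : ℕ) (c : ∀ j, Fin (X j).width → R) :
    Fin (∑ j : Fin (m + 1), (X j).width) → R :=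
  fun s => c ((X.colEquiv m).symm s).1 ((X.colEquiv m).symm s).2

lemma coeffs_assemble (c : ∀ j, Fin (X j).width → R) {j : ℕ} (hj : j < m + 1) :
    X.coeffs m (X.assemble m c) j = c j := by
  ext a
  rw [coeffs, dif_pos hj, assemble]
  exact congrArg (fun s : Σ j : Fin (m + 1), Fin (X j).width => c s.1 s.2)
    ((X.colEquiv m).symm_apply_apply ⟨⟨j, hj⟩, a⟩)

lemma coeffs_injective {c : Fin (∑ j : Fin (m + 1), (X j).width) → R}
    (h : ∀ j ≤ m, X.coeffs m c j = 0) : c = 0 := by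
  ext s
  obtain ⟨⟨j, a⟩, rfl⟩ := (X.colEquiv m).surjective s
  have := congrFun (h j (by omega)) a
  rwa [coeffs, dif_pos j.2] at this

namespace IsGradedBasis

lemma sum_mem (hK : Monotone K) (h : X.IsGradedBasis K m) (c : ∀ j, Fin (X j).width → R)
    {J : ℕ} (hJ : J ≤ m + 1) : ∑ j ∈ Finset.range J, (X j).mat *ᵥ c j ∈ K (J - 1) :=
  Submodule.sum_mem _ fun j hj => by
    have := Finset.mem_range.1 hj
    exact hK (by omega) ((h j (by omega)).mem (c j))

/-- Modulo `K (J - 1)` only the top block of the sum survives, so its coefficients vanish; then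
descend. -/
lemma eq_zero_of_sum_eq_zero (hK : Monotone K) (h : X.IsGradedBasis K m)
    (c : ∀ j, Fin (X j).width → R) : ∀ J ≤ m + 1,
      ∑ j ∈ Finset.range J, (X j).mat *ᵥ c j = 0 → ∀ j < J, c j = 0
  | 0, _, _, j, hj => by omega
  | J + 1, hJ, h0, j, hj => by
    rw [Finset.sum_range_succ] at h0
    have hc : c J = 0 := by
      refine (h J (by omega)).eq_zero _ ?_
      rw [eq_neg_of_add_eq_zero_right h0]
      exact Submodule.neg_mem _ (h.sum_mem hK c (by omega))
    rw [hc, Matrix.mulVec_zero, add_zero] at h0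
    rcases Nat.lt_succ_iff_lt_or_eq.1 hj with hj | rfl
    · exact eq_zero_of_sum_eq_zero hK h c J (by omega) h0 j hj
    · exact hc

/-- The top block corrects `x` into the previous step of the filtration. The descent ends at `K 0 =
⊥`; there `j - 1 = j` and the block `X 0` contributes nothing. -/
lemma exists_sum_eq (h0 : K 0 = ⊥) (h : X.IsGradedBasis K m) : ∀ J ≤ m, ∀ x ∈ K J,
    ∃ c : ∀ j, Fin (X j).width → R, x = ∑ j ∈ Finset.range (J + 1), (X j).mat *ᵥ c j
  | 0, _, x, hx => by
    rw [h0, Submodule.mem_bot] at hx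
    exact ⟨0, by simp [hx]⟩
  | J + 1, hJ, x, hx => by
    obtain ⟨b, hb⟩ := (h (J + 1) hJ).exists_sub_mem x hx
    obtain ⟨c, hc⟩ := exists_sum_eq h0 h J (by omega) _ hb
    refine ⟨Function.update c (J + 1) b, ?_⟩
    rw [Finset.sum_range_succ, Function.update_self, ← sub_eq_iff_eq_add, hc]
    refine Finset.sum_congr rfl fun j hj => ?_
    rw [Function.update_of_ne (by have := Finset.mem_range.1 hj; omega)]

lemma spanUpTo_eq (h0 : K 0 = ⊥) (hK : Monotone K) (h : X.IsGradedBasis K m) {j : ℕ}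
    (hj : j ≤ m) : X.spanUpTo j = K j := by
  apply le_antisymm
  · refine Submodule.span_le.2 ?_
    rintro _ ⟨l, hl, c, rfl⟩
    have := (h l (hl.trans hj)).mem (Pi.single c 1)
    rw [Matrix.mulVec_single_one] at this
    exact hK hl this
  · intro x hx
    obtain ⟨c, rfl⟩ := h.exists_sum_eq h0 j hj x hx
    exact Submodule.sum_mem _ fun l hl =>
      mulVec_mem_spanUpTo (by have := Finset.mem_range.1 hl; omega) _

/-- The matrix is not square by its type, so a two-sided inverse is obtained from the bijectivity of
the linear map rather than from a determinant. -/
lemma exists_inverse (h0 : K 0 = ⊥) (hK : Monotone K) (htop : K m = ⊤)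
    (h : X.IsGradedBasis K m) : ∃ Z, IsInverseMatrix (X.toMatrix m) Z := by
  have hbij : Function.Bijective (X.toMatrix m).mulVecLin := by
    constructor
    · refine (injective_iff_map_eq_zero _).2 fun c hc => coeffs_injective fun j hj => ?_
      rw [Matrix.mulVecLin_apply, toMatrix_mulVec] at hc
      exact h.eq_zero_of_sum_eq_zero hK _ _ le_rfl hc j (by omega)
    · intro x
      obtain ⟨c, hc⟩ := h.exists_sum_eq h0 m le_rfl x (htop ▸ Submodule.mem_top)
      refine ⟨X.assemble m c, ?_⟩
      rw [Matrix.mulVecLin_apply, toMatrix_mulVec, hc]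
      exact Finset.sum_congr rfl fun j hj => by rw [coeffs_assemble _ (Finset.mem_range.1 hj)]
  let e := LinearEquiv.ofBijective _ hbij
  have hM : X.toMatrix m = LinearMap.toMatrix' (e : _ →ₗ[R] _) := by
    rw [show (e : _ →ₗ[R] _) = (X.toMatrix m).mulVecLin from rfl, ← Matrix.toLin'_apply',
      LinearMap.toMatrix'_toLin']
  refine ⟨LinearMap.toMatrix' (e.symm : _ →ₗ[R] _), ?_, ?_⟩
  · rw [hM, ← LinearMap.toMatrix'_comp]
    simp
  · rw [hM, ← LinearMap.toMatrix'_comp]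
    simp

end IsGradedBasis

section Inverse

variable {Z : Matrix (Fin (∑ j : Fin (m + 1), (X j).width)) (Fin n) R}

lemma rows_mulVec_col (hZ : IsInverseMatrix (X.toMatrix m) Z) (j : Fin (m + 1)) {l : ℕ}
    (hl : l < m + 1) (c : Fin (X l).width) (hne : l ≠ j) :
    X.rows Z j *ᵥ (fun x => (X l).mat x c) = 0 := by
  ext a
  have := congrFun (congrFun hZ.1 (X.colEquiv m ⟨j, a⟩)) (X.colEquiv m ⟨⟨l, hl⟩, c⟩)
  rw [Matrix.one_apply_ne] at this
  · simp only [Matrix.mul_apply, toMatrix_apply] at this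
    exact this
  · intro h
    have := (X.colEquiv m).injective h
    exact hne (congrArg (fun s => (s.1 : ℕ)) this).symm

lemma rows_mul_self (hZ : IsInverseMatrix (X.toMatrix m) Z) (j : Fin (m + 1)) :
    X.rows Z j * (X j).mat = 1 := by
  ext a c
  have := congrFun (congrFun hZ.1 (X.colEquiv m ⟨j, a⟩)) (X.colEquiv m ⟨j, c⟩)
  simp only [Matrix.mul_apply, toMatrix_apply] at this
  rw [Matrix.mul_apply]
  refine this.trans ?_
  simp [Matrix.one_apply]

lemma rows_mulVec_eq_zero (hZ : IsInverseMatrix (X.toMatrix m) Z) (j : Fin (m + 1)) {l : ℕ}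
    (hl : l < j) {x : Fin n → R} (hx : x ∈ X.spanUpTo l) : X.rows Z j *ᵥ x = 0 := by
  suffices X.spanUpTo l ≤ LinearMap.ker (X.rows Z j).mulVecLin from LinearMap.mem_ker.1 (this hx)
  refine Submodule.span_le.2 ?_
  rintro _ ⟨l', hl', c, rfl⟩
  exact LinearMap.mem_ker.2 (rows_mulVec_col hZ j (by omega) c (by omega))

/-- The rows of the inverse that belong to `X^j` read off the `X^j`-coordinates of `x`; subtracting
that component leaves only earlier blocks. -/
lemma sub_mulVec_rows_mem (hZ : IsInverseMatrix (X.toMatrix m) Z) (j : Fin (m + 1))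
    {x : Fin n → R} (hx : x ∈ X.spanUpTo j) :
    x - (X j).mat *ᵥ (X.rows Z j *ᵥ x) ∈ X.spanUpTo (j - 1) := by
  suffices X.spanUpTo j ≤ (X.spanUpTo (j - 1)).comap
      (LinearMap.id - (X j).mat.mulVecLin ∘ₗ (X.rows Z j).mulVecLin) by
    simpa using this hx
  refine Submodule.span_le.2 ?_
  rintro _ ⟨l, hl, c, rfl⟩
  simp only [Submodule.comap_coe, Set.mem_preimage, LinearMap.sub_apply, LinearMap.id_apply,
    LinearMap.comp_apply, Matrix.mulVecLin_apply, SetLike.mem_coe]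
  rcases eq_or_ne l (j : ℕ) with rfl | hne
  · rw [show (fun x => (X j).mat x c) = (X j).mat *ᵥ Pi.single c 1 by
      rw [Matrix.mulVec_single_one]; rfl, Matrix.mulVec_mulVec _ (X.rows Z j), rows_mul_self hZ,
      Matrix.one_mulVec, sub_self]
    exact Submodule.zero_mem _
  · rw [rows_mulVec_col hZ j (by omega) c hne, Matrix.mulVec_zero, sub_zero]
    exact Submodule.subset_span ⟨l, by omega, c, rfl⟩

end Inverse

end BlockRow

namespace MatrixModule

variable (F : MatrixModule R m)

/-- Apply the structure map `f(i ≤ i+1)` to a vector of `f_i`. -/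
def next (s : Σ i : ℕ, (Fin (F.dim i) → R)) : Σ i : ℕ, (Fin (F.dim i) → R) :=
  ⟨s.1 + 1, F.mat s.1 *ᵥ s.2⟩

lemma next_iterate (a : ℕ) (v : Fin (F.dim a) → R) :
    ∀ n, F.next^[n] ⟨a, v⟩ = ⟨a + n, F.trans a n *ᵥ v⟩
  | 0 => by simp [trans]
  | n + 1 => by
    rw [Function.iterate_succ_apply', next_iterate a v n, next, trans, ← Matrix.mulVec_mulVec]
    rfl

lemma mem_ker_add {a n : ℕ} {v : Fin (F.dim a) → R} :
    v ∈ F.ker a (a + n) ↔ F.trans a n *ᵥ v = 0 := by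
  have : ∀ t, t = n → (v ∈ LinearMap.ker (F.trans a t).mulVecLin ↔ F.trans a n *ᵥ v = 0) := by
    rintro t rfl
    rfl
  rw [ker, if_pos (by omega), this _ (by omega)]

lemma mem_ker_iff_next {a n : ℕ} {v : Fin (F.dim a) → R} :
    v ∈ F.ker a (a + n) ↔ (F.next^[n] ⟨a, v⟩).2 = 0 := by
  rw [mem_ker_add, next_iterate]

/-- This shift of kernels makes the induced maps between graded pieces injective. `trans` splits off
the last map, whereas here the first one is needed; iterating `next` on pairs of index and vector
gives both without transport between `F.dim (a + 1 + n)` and `F.dim (a + (n + 1))`. -/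
lemma mem_ker_succ {a j : ℕ} (h : a + 1 ≤ j) {v : Fin (F.dim a) → R} :
    v ∈ F.ker a j ↔ F.mat a *ᵥ v ∈ F.ker (a + 1) j := by
  obtain ⟨n, rfl⟩ := Nat.exists_eq_add_of_le h
  rw [mem_ker_iff_next, show a + 1 + n = a + (n + 1) by omega, mem_ker_iff_next,
    Function.iterate_succ_apply]
  rfl

lemma mem_ker_add_succ {a n : ℕ} {v : Fin (F.dim a) → R} :
    v ∈ F.ker a (a + n + 1) ↔ F.mat (a + n) *ᵥ (F.trans a n *ᵥ v) = 0 := by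
  rw [Matrix.mulVec_mulVec]
  exact F.mem_ker_add (n := n + 1)

lemma ker_of_le {a j : ℕ} (h : j ≤ a) : F.ker a j = ⊥ := by
  rcases h.lt_or_eq with h | rfl
  · rw [ker, if_neg (by omega)]
  · refine (Submodule.eq_bot_iff _).2 fun v hv => ?_
    simpa [trans] using (F.mem_ker_add (n := 0)).1 hv

lemma ker_mono (a : ℕ) : Monotone (F.ker a) := by
  refine monotone_nat_of_le_succ fun j v hv => ?_
  rcases le_or_gt j a with h | h
  · rw [F.ker_of_le h, Submodule.mem_bot] at hv
    rw [hv]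
    exact Submodule.zero_mem _
  · obtain ⟨n, rfl⟩ := Nat.exists_eq_add_of_le h.le
    rw [mem_ker_add_succ, F.mem_ker_add.1 hv, Matrix.mulVec_zero]

lemma ker_eq_top {a j : ℕ} (h : m ≤ j) : F.ker a j = ⊤ := by
  refine eq_top_iff.2 fun v _ => ?_
  rcases le_or_gt a j with h' | h'
  · obtain ⟨n, rfl⟩ := Nat.exists_eq_add_of_le h'
    refine F.mem_ker_add.2 (funext fun x => ?_)
    exact (Fin.cast (F.dim_of_ge _ h) x).elim0
  · rw [show v = 0 from funext fun x => (Fin.cast (F.dim_of_ge _ (h.trans h'.le)) x).elim0]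
    exact Submodule.zero_mem _

variable {F}

lemma IsKernelFiltration.isGradedBasis {a : ℕ} {X : BlockRow R (F.dim a)}
    (h : F.IsKernelFiltration a X) : X.IsGradedBasis (F.ker a) m := by
  obtain ⟨⟨Z, hZ⟩, hX⟩ := h
  refine fun j hj => ⟨fun c => ?_, fun x hx => ?_, fun c hc => ?_⟩
  · rw [← hX j hj]
    exact BlockRow.mulVec_mem_spanUpTo le_rfl c
  · rw [← hX j hj] at hx
    rw [← hX (j - 1) (by omega)]
    exact ⟨_, BlockRow.sub_mulVec_rows_mem hZ ⟨j, by omega⟩ hx⟩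
  · have hc' : X.rows Z ⟨j, by omega⟩ *ᵥ ((X j).mat *ᵥ c) = c := by
      rw [Matrix.mulVec_mulVec, BlockRow.rows_mul_self hZ ⟨j, _⟩, Matrix.one_mulVec]
    rw [← hc']
    -- For `j = 0` the truncated `j - 1` is not smaller than `j`, but the kernel is zero there.
    rcases Nat.eq_zero_or_pos j with rfl | hpos
    · rw [F.ker_of_le (by omega), Submodule.mem_bot] at hc
      rw [hc, Matrix.mulVec_zero]
    · rw [← hX (j - 1) (by omega)] at hc
      exact BlockRow.rows_mulVec_eq_zero hZ ⟨j, by omega⟩ (show j - 1 < j by omega) hc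

/-- The graded form is a separate condition on each block, so a filtration matrix can be built and
checked block by block; invertibility of the whole then comes for free. -/
lemma isKernelFiltration_iff {a : ℕ} {X : BlockRow R (F.dim a)} :
    F.IsKernelFiltration a X ↔ X.IsGradedBasis (F.ker a) m :=
  ⟨fun h => h.isGradedBasis, fun h =>
    ⟨h.exists_inverse (F.ker_of_le (Nat.zero_le _)) (F.ker_mono a) (F.ker_eq_top le_rfl),
      fun _ hj => h.spanUpTo_eq (F.ker_of_le (Nat.zero_le _)) (F.ker_mono a) hj⟩⟩

end MatrixModule

end GradedBasis

/-! ### What a Smith normal form provides: kernels, inverses, complements -/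

section Smith

variable {R : Type u} [CommRing R]

open Matrix

/-- The `p × q` matrix with the entries `c_1, …, c_r` on the diagonal and zeros elsewhere. -/
def rectDiagonal (p q : ℕ) {r : ℕ} (c : Fin r → R) : Matrix (Fin p) (Fin q) R :=
  Matrix.of fun x y => if h : (x : ℕ) = y ∧ (x : ℕ) < r then c ⟨x, h.2⟩ else 0

lemma rectDiagonal_mulVec {p q r : ℕ} (hr : r ≤ q) (c : Fin r → R) (v : Fin q → R) (x : Fin p) :
    (rectDiagonal p q c *ᵥ v) x
      = if h : (x : ℕ) < r then c ⟨x, h⟩ * v ⟨x, h.trans_le hr⟩ else 0 := by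
  rw [Matrix.mulVec, dotProduct]
  split_ifs with h
  · rw [Finset.sum_eq_single ⟨x, h.trans_le hr⟩]
    · simp [rectDiagonal, h]
    · intro y _ hy
      have : (x : ℕ) ≠ y := fun hxy => hy (Fin.ext hxy.symm)
      simp [rectDiagonal, this]
    · simp
  · exact Finset.sum_eq_zero fun y _ => by simp [rectDiagonal, h]

lemma rectDiagonal_mul_rectDiagonal {p q : ℕ} {c c' : Fin p → R} (hq : p = q)
    (hc : ∀ a, c a * c' a = 1) : rectDiagonal p q c * rectDiagonal q p c' = 1 := by
  subst hq
  have key : ∀ c : Fin p → R, rectDiagonal p p c = Matrix.diagonal c := fun c => by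
    ext x y
    by_cases h : x = y
    · simp [rectDiagonal, h]
    · have : (x : ℕ) ≠ y := fun h' => h (Fin.ext h')
      simp [rectDiagonal, this, h]
  rw [key, key, Matrix.diagonal_mul_diagonal, ← Matrix.diagonal_one]
  exact congrArg _ (funext hc)

namespace SmithFactorization

variable {p q : ℕ} {A : Matrix (Fin p) (Fin q) R} (fac : SmithFactorization A)

lemma mul_eq : fac.S * A * fac.T = rectDiagonal p q fac.elem := fac.factorization

lemma mulVec_T_bijective : Function.Bijective fac.T.mulVec :=
  ⟨Matrix.mulVec_injective_of_isUnit fac.isUnit_T,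
    Matrix.mulVec_surjective_iff_isUnit.2 fac.isUnit_T⟩

lemma mulVec_S_injective : Function.Injective fac.S.mulVec :=
  Matrix.mulVec_injective_of_isUnit fac.isUnit_S

lemma S_mulVec (t : Fin q → R) :
    fac.S *ᵥ (A *ᵥ (fac.T *ᵥ t)) = rectDiagonal p q fac.elem *ᵥ t := by
  rw [← fac.mul_eq, Matrix.mulVec_mulVec, Matrix.mulVec_mulVec, Matrix.mul_assoc]

/-- `A T` applied to `t` vanishes if and only if the first `r` coordinates of `t` do. -/
lemma mulVec_eq_zero_iff [IsDomain R] (t : Fin q → R) :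
    A *ᵥ (fac.T *ᵥ t) = 0 ↔ ∀ a : Fin fac.rank, t (Fin.castLE fac.rank_le_cols a) = 0 := by
  rw [← fac.mulVec_S_injective.eq_iff, fac.S_mulVec, Matrix.mulVec_zero]
  constructor
  · intro h a
    have := congrFun h (Fin.castLE fac.rank_le_rows a)
    have ha : (Fin.castLE fac.rank_le_rows a : ℕ) < fac.rank := a.2
    rw [rectDiagonal_mulVec fac.rank_le_cols, dif_pos ha] at this
    exact (mul_eq_zero.1 this).resolve_left (fac.elem_ne_zero a)
  · intro h
    ext x
    rw [rectDiagonal_mulVec fac.rank_le_cols]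
    split_ifs with hx
    · exact (congrArg _ (h ⟨x, hx⟩)).trans (mul_zero _)
    · rfl

/-- Otherwise the diagonal form has a zero column, and the corresponding column of `T` is a nonzero
vector killed by `A`. -/
lemma rank_eq_of_injective [IsDomain R] (h : ∀ t, A *ᵥ t = 0 → t = 0) : fac.rank = q := by
  by_contra hne
  have hlt : fac.rank < q := lt_of_le_of_ne fac.rank_le_cols hne
  have h1 : A *ᵥ (fac.T *ᵥ Pi.single ⟨fac.rank, hlt⟩ 1) = 0 := by
    rw [fac.mulVec_eq_zero_iff]
    intro a
    rw [Pi.single_eq_of_ne]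
    intro h
    have := congrArg Fin.val h
    simp at this
    omega
  have h2 := fac.mulVec_T_bijective.1 ((h _ h1).trans (Matrix.mulVec_zero fac.T).symm)
  have := congrFun h2 ⟨fac.rank, hlt⟩
  simp at this

end SmithFactorization

section Columns

variable {R : Type u} {p q r : ℕ}

/-- A vector with the given first `r` and last `q - r` coordinates. -/
def joinCoords (h : r ≤ q) (c : Fin r → R) (c' : Fin (q - r) → R) : Fin q → R :=
  fun y => if hy : (y : ℕ) < r then c ⟨y, hy⟩ else c' ⟨y - r, by omega⟩

lemma mulVec_joinCoords [CommRing R] (M : Matrix (Fin p) (Fin q) R) (h : r ≤ q) (c : Fin r → R)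
    (c' : Fin (q - r) → R) :
    M *ᵥ joinCoords h c c' = firstCols M h *ᵥ c + lastCols M h *ᵥ c' := by
  ext x
  obtain ⟨s, rfl⟩ := Nat.exists_eq_add_of_le h
  have e : r + (r + s - r) = r + s := by omega
  rw [Pi.add_apply, Matrix.mulVec, dotProduct, ← (finCongr e).sum_comp, Fin.sum_univ_add]
  congr 1
  · refine Finset.sum_congr rfl fun a _ => ?_
    simp [joinCoords, firstCols]
    rfl
  · refine Finset.sum_congr rfl fun a _ => ?_
    simp [joinCoords, lastCols]
    rfl

lemma exists_joinCoords (h : r ≤ q) (t : Fin q → R) : ∃ c c', t = joinCoords h c c' := by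
  refine ⟨fun a => t (Fin.castLE h a), fun a => t ⟨r + a, by omega⟩, funext fun y => ?_⟩
  rw [joinCoords]
  split_ifs with hy
  · rfl
  · exact congrArg t (Fin.ext (by simp; omega))

lemma joinCoords_castLE (h : r ≤ q) (c : Fin r → R) (c' : Fin (q - r) → R) (a : Fin r) :
    joinCoords h c c' (Fin.castLE h a) = c a := by
  simp [joinCoords]

lemma joinCoords_add (h : r ≤ q) (c : Fin r → R) (c' : Fin (q - r) → R) (a : Fin (q - r)) :
    joinCoords h c c' ⟨r + a, by omega⟩ = c' a := by
  simp [joinCoords]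

end Columns

/-- The algorithm for inverting unimodular matrices is correct. -/
lemma invertMatrix_returns [Nontrivial R] {proc : MatrixProcedures R} {p q : ℕ}
    {M : Matrix (Fin p) (Fin q) R} (hM : ∃ Z, IsInverseMatrix M Z)
    {Z : Matrix (Fin q) (Fin p) R} (hZ : (invertMatrix proc M).Returns Z) :
    IsInverseMatrix M Z := by
  simp only [invertMatrix, invertDivisors, writeMatrix, Timed.returns_bind,
    Timed.returns_step] at hZ
  obtain ⟨fac, -, _, rfl, _, rfl, TD, -, Z', -, rfl⟩ := hZ
  rw [Z'.2, TD.2]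
  obtain ⟨Z₀, h1, h2⟩ := hM
  obtain ⟨S', hS⟩ := fac.isUnit_S.exists_right_inv
  obtain ⟨T', hT⟩ := fac.isUnit_T.exists_right_inv
  have hS' := mul_eq_one_comm.1 hS
  have hT' := mul_eq_one_comm.1 hT
  set D := rectDiagonal p q fac.elem with hD
  -- This is the inverse of the diagonal form `D`. Its existence forces `D` to have neither a zero
  -- row nor a zero column, hence to be square of full rank, with unit entries.
  set E := T' * Z₀ * S' with hE
  have hDE : D * E = 1 := by
    rw [hD, hE, ← fac.mul_eq]
    calc fac.S * M * fac.T * (T' * Z₀ * S') = fac.S * (M * ((fac.T * T') * Z₀)) * S' := by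
          simp only [Matrix.mul_assoc]
      _ = 1 := by rw [hT, Matrix.one_mul, h2, Matrix.mul_one, hS]
  have hED : E * D = 1 := by
    rw [hD, hE, ← fac.mul_eq]
    calc T' * Z₀ * S' * (fac.S * M * fac.T) = T' * (Z₀ * ((S' * fac.S) * M)) * fac.T := by
          simp only [Matrix.mul_assoc]
      _ = 1 := by rw [hS', Matrix.one_mul, h1, Matrix.mul_one, hT']
  have hentry : ∀ x : Fin p, ∃ h : (x : ℕ) < fac.rank, fac.elem ⟨x, h⟩ *
      E ⟨x, h.trans_le fac.rank_le_cols⟩ x = 1 := fun x => by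
    have := congrFun (congrArg (· *ᵥ Pi.single x (1 : R)) hDE) x
    simp only [← Matrix.mulVec_mulVec, Matrix.one_mulVec] at this
    rw [hD, rectDiagonal_mulVec fac.rank_le_cols] at this
    split_ifs at this with h
    · exact ⟨h, by simpa using this⟩
    · simp at this
  have hp : fac.rank = p := le_antisymm fac.rank_le_rows (by
    by_contra h
    obtain ⟨h', -⟩ := hentry ⟨fac.rank, by omega⟩
    exact lt_irrefl _ h')
  have hq : p = q := le_antisymm (hp ▸ fac.rank_le_cols) (by
    by_contra h
    have : (E *ᵥ (D *ᵥ Pi.single ⟨p, by omega⟩ (1 : R))) = Pi.single ⟨p, by omega⟩ 1 := by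
      rw [Matrix.mulVec_mulVec, hED, Matrix.one_mulVec]
    rw [show D *ᵥ Pi.single ⟨p, by omega⟩ (1 : R) = 0 from funext fun x => by
      rw [hD, rectDiagonal_mulVec fac.rank_le_cols]
      split_ifs
      · rw [Pi.single_eq_of_ne, mul_zero]
        · rfl
        · intro h
          have := congrArg Fin.val h
          simp at this
          omega
      · rfl, Matrix.mulVec_zero] at this
    have := congrFun this ⟨p, by omega⟩
    simp at this)
  have hunit : ∀ a, IsUnit (fac.elem a) := fun a => by
    obtain ⟨h, h'⟩ := hentry (Fin.castLE fac.rank_le_rows a)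
    exact IsUnit.of_mul_eq_one _ h'
  -- Stated for a variable `r`, because the projection `fac.rank` cannot be replaced by `p` through
  -- substitution.
  have hinv : ∀ {p' q' : ℕ} (_ : p' = q') {r : ℕ} (_ : r = p') (c c' : Fin r → R),
      (∀ a, c a * c' a = 1) → rectDiagonal p' q' c * rectDiagonal q' p' c' = 1 := by
    rintro p' q' h r rfl c c' hc
    exact rectDiagonal_mul_rectDiagonal h hc
  set D' : Matrix (Fin q) (Fin p) R := rectDiagonal q p fun a => Ring.inverse (fac.elem a) with hD'
  have h3 : D * D' = 1 := hinv hq hp _ _ fun a => Ring.mul_inverse_cancel _ (hunit a)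
  have h4 : D' * D = 1 := hinv hq.symm (hp.trans hq) _ _ fun a =>
    Ring.inverse_mul_cancel _ (hunit a)
  change IsInverseMatrix M (fac.T * D' * fac.S)
  constructor
  -- A one-sided inverse of a square matrix is two-sided, so `fac.T` may be moved to the front.
  · have : D' * fac.S * M * fac.T = 1 := by
      rw [← h4, hD, ← fac.mul_eq]
      simp only [Matrix.mul_assoc]
    have := mul_eq_one_comm.1 this
    simpa only [Matrix.mul_assoc] using this
  · have : fac.S * (M * fac.T * D') = 1 := by
      rw [← h3, hD, ← fac.mul_eq]
      simp only [Matrix.mul_assoc]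
    have := mul_eq_one_comm.1 this
    simpa only [Matrix.mul_assoc] using this

/-- The columns of `A` and of the computed complement together form a basis. -/
lemma computeComplement_returns [Nontrivial R] {proc : MatrixProcedures R} {p q : ℕ}
    {A : Matrix (Fin p) (Fin q) R} {fac : SmithFactorization A} (hr : fac.rank = q)
    (hu : ∀ a, IsUnit (fac.elem a)) {B : Matrix (Fin p) (Fin (p - fac.rank)) R}
    (hB : (computeComplement proc fac).Returns B) :
    (∀ x, ∃ b t, x = B *ᵥ b + A *ᵥ t) ∧ ∀ b t, B *ᵥ b + A *ᵥ t = 0 → b = 0 ∧ t = 0 := by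
  simp only [computeComplement, writeMatrix, Timed.returns_bind, Timed.returns_step] at hB
  obtain ⟨S', hS', rfl⟩ := hB
  obtain ⟨S₀, hS₀⟩ := fac.isUnit_S.exists_right_inv
  obtain ⟨h1, h2⟩ := invertMatrix_returns ⟨S₀, mul_eq_one_comm.1 hS₀, hS₀⟩ hS'
  have hrp := fac.rank_le_rows
  have hlast : ∀ b, lastCols S' hrp *ᵥ b = S' *ᵥ joinCoords hrp 0 b := fun b => by
    rw [mulVec_joinCoords, Matrix.mulVec_zero, zero_add]
  have hA : ∀ t, A *ᵥ (fac.T *ᵥ t) = S' *ᵥ (rectDiagonal p q fac.elem *ᵥ t) := fun t => by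
    rw [← fac.S_mulVec, Matrix.mulVec_mulVec _ S', h1, Matrix.one_mulVec]
  -- In the coordinates given by `S`, the complement fills the last `p - fac.rank` places, and the
  -- columns of `A T` fill the first ones up to units.
  have hdiag : ∀ (b : Fin (p - fac.rank) → R) (t : Fin q → R),
      joinCoords hrp 0 b + rectDiagonal p q fac.elem *ᵥ t
        = joinCoords hrp (fun a => fac.elem a * t (Fin.cast hr a)) b := fun b t => by
    ext x
    rw [Pi.add_apply, rectDiagonal_mulVec fac.rank_le_cols, joinCoords, joinCoords]
    split_ifs with h
    · simp
    · simp
  constructor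
  · intro x
    obtain ⟨c, b, hcb⟩ := exists_joinCoords hrp (fac.S *ᵥ x)
    refine ⟨b, fac.T *ᵥ fun y => Ring.inverse (fac.elem (Fin.cast hr.symm y)) *
      c (Fin.cast hr.symm y), ?_⟩
    rw [hlast, hA, ← Matrix.mulVec_add, hdiag]
    have : (fun a => fac.elem a * (Ring.inverse (fac.elem (Fin.cast hr.symm (Fin.cast hr a))) *
      c (Fin.cast hr.symm (Fin.cast hr a)))) = c := funext fun a =>
        Ring.mul_inverse_cancel_left _ (c a) (hu a)
    rw [this, ← hcb, Matrix.mulVec_mulVec, h1, Matrix.one_mulVec]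
  · intro b t h
    obtain ⟨t, rfl⟩ := fac.mulVec_T_bijective.2 t
    rw [hlast, hA, ← Matrix.mulVec_add, hdiag] at h
    have h0 : joinCoords hrp (fun a => fac.elem a * t (Fin.cast hr a)) b = 0 := by
      rw [← Matrix.one_mulVec (joinCoords _ _ _), ← h2, ← Matrix.mulVec_mulVec, h,
        Matrix.mulVec_zero]
    constructor
    · ext a
      rw [← joinCoords_add hrp (fun a => fac.elem a * t (Fin.cast hr a)) b a, h0]
      rfl
    · have ht : t = 0 := by
        ext y
        have := joinCoords_castLE hrp (fun a => fac.elem a * t (Fin.cast hr a)) b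
          (Fin.cast hr.symm y)
        rw [h0] at this
        exact ((hu _).mul_right_eq_zero.1 this.symm)
      rw [ht, Matrix.mulVec_zero]

end Smith

/-! ### Invariants of the loops -/

section Correctness

open Matrix

variable {R : Type u} [CommRing R] {m : ℕ} {F : MatrixModule R m}

lemma Block.isBasisModulo_bot {n : ℕ} (K' : Submodule R (Fin n → R)) {B : Block R n}
    (hB : B.width = 0) : B.IsBasisModulo ⊥ K' := by
  have hc : ∀ c : Fin B.width → R, c = 0 := fun c => funext fun a => (Fin.cast hB a).elim0
  refine ⟨fun c => ?_, fun x hx => ⟨0, ?_⟩, fun c _ => hc c⟩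
  · rw [hc c, Matrix.mulVec_zero]
    exact Submodule.zero_mem _
  · rw [(Submodule.mem_bot R).1 hx, Matrix.mulVec_zero, sub_zero]
    exact Submodule.zero_mem _

namespace MatrixModule

lemma isGradedBasis_empty {a j : ℕ} (h : j ≤ a) :
    (BlockRow.empty R (F.dim a)).IsGradedBasis (F.ker a) j := fun l hl => by
  rw [F.ker_of_le (hl.trans h)]
  exact Block.isBasisModulo_bot _ rfl

lemma isKernelFiltration_empty {a : ℕ} (h : m ≤ a) :
    F.IsKernelFiltration a (BlockRow.empty R (F.dim a)) :=
  isKernelFiltration_iff.2 (isGradedBasis_empty h)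

/-- Invariant: the columns of `P` represent a basis of f_a modulo Ker[a,a+s], and `G` holds their
images in f_{a+s}. As the elementary divisors are nonzero, the combinations of these columns that
die at the next index are those of `P T⁻`. So `P T⁻` is the next graded piece, and `P T⁺` is a basis
modulo the larger kernel. -/
lemma kernelLoop_returns [IsDomain R] {proc : MatrixProcedures R} {a : ℕ} :
    ∀ {n s r : ℕ} {P : Matrix (Fin (F.dim a)) (Fin r) R}
      {G : Matrix (Fin (F.dim (a + s))) (Fin r) R} {X X' : BlockRow R (F.dim a)},
      G = F.trans a s * P → (∀ x, ∃ c, x - P *ᵥ c ∈ F.ker a (a + s)) →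
      (∀ c, P *ᵥ c ∈ F.ker a (a + s) → c = 0) → X.IsGradedBasis (F.ker a) (a + s) →
      (kernelLoop proc F a n (a + s) r P G X).Returns X' →
      X'.IsGradedBasis (F.ker a) (a + s + n)
  | 0, s, r, P, G, X, X', _, _, _, hX, h => by
    rw [kernelLoop, Timed.returns_step] at h
    rwa [h]
  | n + 1, s, r, P, G, X, X', hG, hgen, hinj, hX, h => by
    subst hG
    simp only [kernelLoop, writeMatrix, Timed.returns_bind, Timed.returns_step] at h
    obtain ⟨⟨H, rfl⟩, -, fac, -, _, rfl, _, rfl, ⟨block, rfl⟩, -, ⟨P', rfl⟩, -, ⟨G', rfl⟩, -,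
      h⟩ := h
    set Tpos := firstCols fac.T fac.rank_le_cols with hpos
    set Tneg := lastCols fac.T fac.rank_le_cols with hneg
    have hker : ∀ c, P *ᵥ c ∈ F.ker a (a + s + 1) ↔
        (F.mat (a + s) * (F.trans a s * P)) *ᵥ c = 0 := fun c => by
      simp only [mem_ker_add_succ, Matrix.mulVec_mulVec]
    have hT : ∀ c₁ c₂, Tpos *ᵥ c₁ + Tneg *ᵥ c₂ = fac.T *ᵥ joinCoords fac.rank_le_cols c₁ c₂ :=
      fun c₁ c₂ => (mulVec_joinCoords _ _ _ _).symm
    have hTker : ∀ c₁ c₂, P *ᵥ (Tpos *ᵥ c₁ + Tneg *ᵥ c₂) ∈ F.ker a (a + s + 1) ↔ c₁ = 0 :=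
      fun c₁ c₂ => by
        rw [hker, hT, fac.mulVec_eq_zero_iff]
        simp only [joinCoords_castLE, funext_iff, Pi.zero_apply]
    have hTsurj : ∀ c, ∃ c₁ c₂, c = Tpos *ᵥ c₁ + Tneg *ᵥ c₂ := fun c => by
      obtain ⟨t, rfl⟩ := fac.mulVec_T_bijective.2 c
      obtain ⟨c₁, c₂, rfl⟩ := exists_joinCoords fac.rank_le_cols t
      exact ⟨c₁, c₂, (hT c₁ c₂).symm⟩
    have hTinj : ∀ c₁ c₂, Tpos *ᵥ c₁ + Tneg *ᵥ c₂ = 0 → c₂ = 0 := fun c₁ c₂ h => by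
      rw [hT, ← Matrix.mulVec_zero fac.T] at h
      ext x
      rw [← joinCoords_add fac.rank_le_cols c₁ c₂ x, fac.mulVec_T_bijective.1 h]
      rfl
    have hmono := F.ker_mono a (Nat.le_succ (a + s))
    rw [show a + s + (n + 1) = a + (s + 1) + n by omega]
    refine kernelLoop_returns (s := s + 1) ?_ (fun x => ?_) (fun c hc => ?_) ?_ h
    · simp only [trans, Matrix.mul_assoc]
    · obtain ⟨c, hc⟩ := hgen x
      obtain ⟨c₁, c₂, rfl⟩ := hTsurj c
      refine ⟨c₁, ?_⟩
      have h1 : _ ∈ F.ker a (a + (s + 1)) := Submodule.add_mem _ (hmono hc) ((hTker 0 c₂).2 rfl)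
      rw [← Matrix.mulVec_mulVec]
      convert h1 using 1
      rw [Matrix.mulVec_zero, zero_add, Matrix.mulVec_add]
      abel
    · refine (hTker c 0).1 ?_
      rw [Matrix.mulVec_zero, add_zero, Matrix.mulVec_mulVec]
      exact hc
    · intro j hj
      rcases Nat.lt_or_ge j (a + s + 1) with hj' | hj'
      · rw [Function.update_of_ne hj'.ne]
        exact hX j (by omega)
      obtain rfl : j = a + s + 1 := le_antisymm hj hj'
      rw [Function.update_self, Nat.add_sub_cancel]
      refine ⟨fun c => ?_, fun x hx => ?_, fun c hc => ?_⟩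
      · rw [← Matrix.mulVec_mulVec]
        simpa using (hTker 0 c).2 rfl
      · obtain ⟨c, hc⟩ := hgen x
        obtain ⟨c₁, c₂, rfl⟩ := hTsurj c
        have h1 := Submodule.sub_mem _ hx (hmono hc)
        rw [sub_sub_cancel] at h1
        -- The vector `x` and its approximation both lie in the larger kernel, so the approximation
        -- has no `T⁺` component.
        obtain rfl := (hTker c₁ c₂).1 h1
        refine ⟨c₂, ?_⟩
        rw [← Matrix.mulVec_mulVec]
        simpa using hc
      · rw [← Matrix.mulVec_mulVec] at hc
        refine hTinj 0 c ?_
        rw [Matrix.mulVec_zero, zero_add]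
        exact hinj _ hc

/-- The computation of kernel filtration matrices is correct. -/
lemma kernelFiltration_returns [IsDomain R] {proc : MatrixProcedures R} {a : ℕ} (ha : a ≤ m)
    {X : BlockRow R (F.dim a)} (h : (kernelFiltration proc F a).Returns X) :
    F.IsKernelFiltration a X := by
  simp only [kernelFiltration, writeMatrix, Timed.returns_bind, Timed.returns_step] at h
  obtain ⟨_, rfl, h⟩ := h
  have := kernelLoop_returns (s := 0) (Matrix.mul_one (F.trans a 0)).symm
    (fun x => ⟨x, by
      rw [Matrix.one_mulVec, sub_self]
      exact Submodule.zero_mem _⟩)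
    (fun c hc => by
      rwa [Matrix.one_mulVec, F.ker_of_le (by omega), Submodule.mem_bot] at hc)
    (isGradedBasis_empty (by omega)) h
  rw [isKernelFiltration_iff]
  rwa [show a + 0 + (m - a) = m by omega] at this

section Step

variable {k : ℕ} {X : BlockRow R (F.dim (k + 1))} {Y : BlockRow R (F.dim k)}
  {Z : Matrix (Fin (∑ j : Fin (m + 1), (X j).width)) (Fin (F.dim (k + 1))) R}

/-- Modulo `Ker[i, j-1]`, the map `f(i-1 ≤ i)` from `Ker[i-1, j]` to `Ker[i, j]` is given by the
matrix `(X_i^j)⁻¹ F_{i-1} Y_{i-1}^j`. -/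
lemma mat_mulVec_sub_mem (hX : F.IsKernelFiltration (k + 1) X)
    (hZ : IsInverseMatrix (X.toMatrix m) Z) (hY : F.IsKernelFiltration k Y) (j : Fin (m + 1))
    (hj : k + 1 < j) (t : Fin (Y j).width → R) :
    F.mat k *ᵥ ((Y j).mat *ᵥ t) -
      (X j).mat *ᵥ ((X.rows Z j * F.mat k * (Y j).mat) *ᵥ t) ∈ F.ker (k + 1) (j - 1) := by
  have h1 := (hY.isGradedBasis j (by omega)).mem t
  rw [F.mem_ker_succ (by omega), ← hX.2 j (by omega)] at h1
  have h2 := BlockRow.sub_mulVec_rows_mem hZ j h1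
  rw [show X.spanUpTo (j - 1) = _ from hX.2 (j - 1) (by omega)] at h2
  simpa only [Matrix.mulVec_mulVec, Matrix.mul_assoc] using h2

/-- If `A t = 0`, then the image of `Y^j t` lies in Ker[k+1,j-1], so `Y^j t` lies in Ker[k,j-1] and
`t = 0`. The strict inequality `k + 1 < j` is what allows `mem_ker_succ` at index `j - 1`. -/
lemma rows_mul_injective (hX : F.IsKernelFiltration (k + 1) X)
    (hZ : IsInverseMatrix (X.toMatrix m) Z) (hY : F.IsKernelFiltration k Y) (j : Fin (m + 1))
    (hj : k + 1 < j) (t : Fin (Y j).width → R)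
    (ht : (X.rows Z j * F.mat k * (Y j).mat) *ᵥ t = 0) : t = 0 := by
  have h := mat_mulVec_sub_mem hX hZ hY j hj t
  rw [ht, Matrix.mulVec_zero, sub_zero, ← F.mem_ker_succ (by omega)] at h
  exact (hY.isGradedBasis j (by omega)).eq_zero t h

/-- The columns of `F_i Y_i^l` are among the columns of `Y_{i+1}^l`. -/
def IsExtension (F : MatrixModule R m) (i : ℕ) (Y : Block R (F.dim i))
    (Y' : Block R (F.dim (i + 1))) : Prop :=
  ∃ φ : Fin Y.width → Fin Y'.width, Function.Injective φ ∧
    ∀ c, (fun x => Y'.mat x (φ c)) = F.mat i *ᵥ fun x => Y.mat x c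

/-- Modulo Ker[k+1,j-1] the new block is `X^j [B | A]`, and the hypotheses say that `[B | A]` acts
bijectively. This is a change of basis of the quotient. -/
lemma isBasisModulo_append (hX : F.IsKernelFiltration (k + 1) X)
    (hZ : IsInverseMatrix (X.toMatrix m) Z) (hY : F.IsKernelFiltration k Y) (j : Fin (m + 1))
    (hj : k + 1 < j) {w : ℕ} {B : Matrix (Fin (X j).width) (Fin w) R}
    (hgen : ∀ x, ∃ b t, x = B *ᵥ b + (X.rows Z j * F.mat k * (Y j).mat) *ᵥ t)
    (hinj : ∀ b t, B *ᵥ b + (X.rows Z j * F.mat k * (Y j).mat) *ᵥ t = 0 → b = 0 ∧ t = 0) :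
    (Block.mk _ (Matrix.of fun x => Fin.append (((X j).mat * B) x)
      ((F.mat k * (Y j).mat) x))).IsBasisModulo (F.ker (k + 1) j) (F.ker (k + 1) (j - 1)) := by
  have hX' := hX.isGradedBasis j (by omega)
  have hmul : ∀ c, (Matrix.of fun x => Fin.append (((X j).mat * B) x)
      ((F.mat k * (Y j).mat) x)) *ᵥ c
      = (X j).mat *ᵥ (B *ᵥ fun a => c (Fin.castAdd _ a))
        + F.mat k *ᵥ ((Y j).mat *ᵥ fun a => c (Fin.natAdd _ a)) := fun c => by
    rw [Matrix.mulVec_mulVec, Matrix.mulVec_mulVec]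
    ext x
    simp only [Pi.add_apply, Matrix.mulVec, dotProduct, Fin.sum_univ_add, Matrix.of_apply,
      Fin.append_left, Fin.append_right]
  have hmem : ∀ t, F.mat k *ᵥ ((Y j).mat *ᵥ t) ∈ F.ker (k + 1) j := fun t =>
    (F.mem_ker_succ (by omega)).1 ((hY.isGradedBasis j (by omega)).mem t)
  refine ⟨fun c => ?_, fun x hx => ?_, fun c hc => ?_⟩
  · rw [hmul]
    exact Submodule.add_mem _ (hX'.mem _) (hmem _)
  · obtain ⟨c, hc⟩ := hX'.exists_sub_mem x hx
    obtain ⟨b, t, rfl⟩ := hgen c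
    refine ⟨Fin.append b t, ?_⟩
    rw [hmul]
    simp only [Fin.append_left, Fin.append_right]
    have := Submodule.sub_mem _ hc (mat_mulVec_sub_mem hX hZ hY j hj t)
    convert this using 1
    rw [Matrix.mulVec_add]
    abel
  · rw [hmul] at hc
    have h1 := Submodule.sub_mem _ hc
      (mat_mulVec_sub_mem hX hZ hY j hj fun a => c (Fin.natAdd _ a))
    rw [add_sub_assoc, sub_sub_cancel, ← Matrix.mulVec_add] at h1
    obtain ⟨h2, h3⟩ := hinj _ _ (hX'.eq_zero _ h1)
    ext a
    refine Fin.addCases (fun a => congrFun h2 a) (fun a => congrFun h3 a) a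

/-- Invariant: every block whose index is no longer in the list is already correct. This includes
the indices up to `k + 1`, which are never processed and whose blocks stay empty. -/
lemma innerLoop_returns [IsDomain R] {proc : MatrixProcedures R} (hk : k + 1 < m)
    (hX : F.IsKernelFiltration (k + 1) X) (hZ : IsInverseMatrix (X.toMatrix m) Z)
    (hY : F.IsKernelFiltration k Y) :
    ∀ {js : List (Fin (m + 1))} {Ynew : BlockRow R (F.dim (k + 1))} {res},
      (∀ j ∈ js, k + 1 < (j : ℕ)) →
      (∀ l : Fin (m + 1), l ∉ js →
        (Ynew l).IsBasisModulo (F.ker (k + 1) l) (F.ker (k + 1) (l - 1)) ∧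
        (k + 1 < l → F.IsExtension k (Y l) (Ynew l))) →
      (innerLoop proc F k X Z Y js Ynew).Returns res →
      (∀ c, res = Sum.inl c → c.Valid) ∧
      ∀ Y', res = Sum.inr Y' → F.IsKernelFiltration (k + 1) Y' ∧
        ∀ l ≤ m, k + 1 < l → F.IsExtension k (Y l) (Y' l)
  | [], Ynew, res, _, hn, h => by
    rw [innerLoop, Timed.returns_step] at h
    subst h
    refine ⟨fun c hc => by simp at hc, fun Y' hY' => ?_⟩
    obtain rfl := Sum.inr_injective hY'
    exact ⟨isKernelFiltration_iff.2 fun l hl => (hn ⟨l, by omega⟩ (by simp)).1,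
      fun l hl => (hn ⟨l, by omega⟩ (by simp)).2⟩
  | j :: js, Ynew, res, hjs, hn, h => by
    simp only [innerLoop, writeMatrix, yieldsComplement, Timed.returns_bind,
      Timed.returns_step] at h
    obtain ⟨_, rfl, ⟨FY, rfl⟩, -, ⟨A, hA⟩, -, fac, -, ok, hok, h⟩ := h
    have hj := hjs j (by simp)
    rw [← Matrix.mul_assoc] at hA
    have hA' : A = X.rows Z j * F.mat k * (Y j).mat := hA
    -- The rank part of the test always succeeds, so a failed test exhibits a non-unit divisor.
    have hrank : fac.rank = (Y j).width := fac.rank_eq_of_injective fun t ht =>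
      rows_mul_injective hX hZ hY j hj t (by rw [← hA']; exact ht)
    cases ok
    · simp only [Bool.false_eq_true, if_false, Timed.returns_step] at h
      subst h
      refine ⟨fun c hc => ?_, fun Y' hY' => by simp at hY'⟩
      obtain rfl := Sum.inl_injective hc
      refine ⟨hk, hj, hX, hY, ⟨Z, hZ, hA'⟩, ?_⟩
      have := by classical exact of_decide_eq_false hok.symm
      simpa [hrank] using this
    · have hu := by classical exact (of_decide_eq_true hok.symm).2
      simp only [if_true, Timed.returns_bind, Timed.returns_step] at h
      obtain ⟨B, hB, ⟨XB, rfl⟩, -, _, rfl, h⟩ := h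
      obtain ⟨hgen, hinj⟩ := computeComplement_returns hrank hu hB
      refine innerLoop_returns hk hX hZ hY (fun l hl => hjs l (by simp [hl])) (fun l hl => ?_) h
      rcases eq_or_ne l j with rfl | hne
      · rw [Function.update_self]
        simp only [hA'] at hgen hinj
        exact ⟨isBasisModulo_append hX hZ hY l hj hgen hinj, fun _ =>
          ⟨Fin.natAdd _, Fin.natAdd_injective _ _, fun c => funext fun x => by
            simp [Matrix.mul_apply, Matrix.mulVec, dotProduct]⟩⟩
      · rw [Function.update_of_ne (fun h => hne (Fin.ext h))]
        exact hn l (by simp [hl, hne])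

end Step

/-- The partitioned matrices `β_0, …, β_k` are kernel filtration matrices, each of which extends the
image of the previous one; the other `β_i` have no columns. -/
structure IsPartialSolution (F : MatrixModule R m) (k : ℕ) (β : ∀ i : ℕ, BlockRow R (F.dim i)) :
    Prop where
  isKernelFiltration : ∀ i ≤ k, F.IsKernelFiltration i (β i)
  isExtension : ∀ i < k, ∀ l ≤ m, i + 1 < l → F.IsExtension i (β i l) (β (i + 1) l)
  eq_empty : ∀ i, k < i → β i = BlockRow.empty R (F.dim i)

lemma outerLoop_returns [IsDomain R] {proc : MatrixProcedures R} :
    ∀ {n k : ℕ} {β : ∀ i : ℕ, BlockRow R (F.dim i)} {out : F.Output}, k + n ≤ m - 1 →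
      F.IsPartialSolution k β → (outerLoop proc F n k (β k) β).Returns out →
      (∀ c, out = Output.halt c → c.Valid) ∧
      ∀ β', out = Output.bases β' → F.IsPartialSolution (k + n) β'
  | 0, k, β, out, _, hβ, h => by
    rw [outerLoop, Timed.returns_step] at h
    subst h
    refine ⟨fun c hc => by simp at hc, fun β' hβ' => ?_⟩
    rw [Output.bases.injEq] at hβ'
    rwa [← hβ']
  | n + 1, k, β, out, hk, hβ, h => by
    simp only [outerLoop, writeMatrix, Timed.returns_bind, Timed.returns_step] at h
    obtain ⟨X, hX, _, rfl, Z, hZ, res, hres, h⟩ := h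
    have hX := kernelFiltration_returns (by omega) hX
    have hZ := invertMatrix_returns hX.1 hZ
    obtain ⟨h1, h2⟩ := innerLoop_returns (by omega) hX hZ (hβ.isKernelFiltration k le_rfl)
      (fun j hj => by simpa using (List.mem_filter.1 hj).2)
      (fun l hl => by
        have hl' : (l : ℕ) ≤ k + 1 := by simpa using hl
        exact ⟨isGradedBasis_empty hl' l le_rfl, fun h => absurd h (by omega)⟩) hres
    rcases res with c | Y'
    · simp only [Timed.returns_step] at h
      subst h
      refine ⟨fun c' hc' => ?_, fun β' hβ' => by simp at hβ'⟩
      rw [Output.halt.injEq] at hc'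
      exact hc' ▸ h1 c rfl
    · obtain ⟨h3, h4⟩ := h2 Y' rfl
      rw [show k + (n + 1) = k + 1 + n by omega]
      refine outerLoop_returns (β := Function.update β (k + 1) Y') (by omega)
        ⟨fun i hi => ?_, fun i hi l hl hil => ?_, fun i hi => ?_⟩ (by
          rw [Function.update_self]
          exact h)
      · rcases eq_or_ne i (k + 1) with rfl | hne
        · rwa [Function.update_self]
        · rw [Function.update_of_ne hne]
          exact hβ.isKernelFiltration i (by omega)
      · rw [Function.update_of_ne (by omega : i ≠ k + 1)]
        rcases eq_or_ne i k with rfl | hne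
        · rw [Function.update_self]
          exact h4 l hl hil
        · rw [Function.update_of_ne (by omega : i + 1 ≠ k + 1)]
          exact hβ.isExtension i (by omega) l hl hil
      · rw [Function.update_of_ne (by omega)]
        exact hβ.eq_empty i (by omega)

lemma algorithm_returns [IsDomain R] {proc : MatrixProcedures R} {out : F.Output}
    (h : (algorithm proc F).Returns out) :
    (∀ c, out = Output.halt c → c.Valid) ∧
    ∀ β, out = Output.bases β → F.IsPartialSolution (m - 1) β := by
  have h0 : F.IsKernelFiltration 0 (BlockRow.empty R (F.dim 0)) := by
    refine isKernelFiltration_iff.2 fun j hj => ?_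
    have : F.ker 0 j = ⊥ := (Submodule.eq_bot_iff _).2 fun v _ =>
      funext fun x => (Fin.cast F.dim_zero x).elim0
    rw [this]
    exact Block.isBasisModulo_bot _ rfl
  have := outerLoop_returns (k := 0) (n := m - 1) (by omega)
    ⟨fun i hi => by
      obtain rfl : i = 0 := by omega
      exact h0, fun i hi => by omega, fun i _ => rfl⟩ h
  rwa [zero_add] at this

end MatrixModule

end Correctness

/-! ### Interval bases and interval decompositions -/

section Decompositions

variable {R : Type u} [CommRing R] {m : ℕ} {f : Fin (m + 1) ⥤ ModuleCat.{u} R}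

/-- The structure map `f(i ≤ j)` as a linear map. -/
abbrev structureMap (f : Fin (m + 1) ⥤ ModuleCat.{u} R) {i j : Fin (m + 1)} (h : i ≤ j) :
    f.obj i →ₗ[R] f.obj j := (f.map (homOfLE h)).hom

lemma structureMap_trans {i j l : Fin (m + 1)} (h : i ≤ j) (h' : j ≤ l) (v : f.obj i) :
    structureMap f h' (structureMap f h v) = structureMap f (h.trans h') v := by
  rw [structureMap, structureMap, structureMap, ← homOfLE_comp h h', f.map_comp]
  rfl

lemma structureMap_refl {i : Fin (m + 1)} (h : i ≤ i) (v : f.obj i) :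
    structureMap f h v = v := by
  rw [structureMap, show homOfLE h = 𝟙 i from rfl, f.map_id]
  rfl

/-- The structure map `f(i ≤ i+1)` as a linear map. -/
abbrev structureMapSucc (f : Fin (m + 1) ⥤ ModuleCat.{u} R) {i : ℕ} (hi : i < m) :
    f.obj ⟨i, by omega⟩ →ₗ[R] f.obj ⟨i + 1, by omega⟩ :=
  structureMap f (show (⟨i, by omega⟩ : Fin (m + 1)) ≤ ⟨i + 1, by omega⟩ by simp)

/-- Properties of bases that are invariant under the maps `f(i ≤ i+1)` extend to all `f(i ≤ j)`. -/
lemma isIntervalBasis_of_succ [Nontrivial R] {ι : Fin (m + 1) → Type} {β : ∀ i, ι i → f.obj i}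
    (hβ : ∀ i, LinearIndependent R (β i) ∧ Submodule.span R (Set.range (β i)) = ⊤)
    (hsucc : ∀ (i : ℕ) (hi : i < m) (x : ι ⟨i, by omega⟩), structureMapSucc f hi (β _ x) = 0 ∨
      (structureMapSucc f hi (β _ x) ∈ Set.range (β _) ∧
        ∀ y, structureMapSucc f hi (β _ y) = structureMapSucc f hi (β _ x) → y = x)) :
    IsIntervalBasis f β := by
  refine ⟨hβ, ?_⟩
  rintro ⟨i, hi⟩ ⟨j, hj⟩ h
  obtain ⟨n, rfl⟩ := Nat.exists_eq_add_of_le (show i ≤ j from h)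
  change ∀ x, structureMap f h (β _ x) = 0 ∨ (structureMap f h (β _ x) ∈ Set.range (β _) ∧
    ∀ y, structureMap f h (β _ y) = structureMap f h (β _ x) → y = x)
  induction n with
  | zero =>
    intro x
    simp only [structureMap_refl]
    exact Or.inr ⟨⟨x, rfl⟩, fun y hy => (hβ _).1.injective hy⟩
  | succ n ih =>
    intro x
    have h1 : (⟨i, hi⟩ : Fin (m + 1)) ≤ ⟨i + n, by omega⟩ := by simp
    have h2 : (⟨i + n, by omega⟩ : Fin (m + 1)) ≤ ⟨i + n + 1, by omega⟩ := by simp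
    have htr : ∀ v, structureMap f h v = structureMap f h2 (structureMap f h1 v) := fun v =>
      (structureMap_trans h1 h2 v).symm
    simp only [htr]
    rcases ih (by omega) h1 x with h0 | ⟨⟨z, hz⟩, hx⟩
    · left
      rw [h0, map_zero]
    rcases hsucc (i + n) (by omega) z with h0 | ⟨⟨w, hw⟩, hz'⟩
    · left
      rw [← hz, h0]
    right
    rw [← hz]
    refine ⟨⟨w, hw⟩, fun y hy => hx y ?_⟩
    -- The competitor `y` must still be alive at `i + n`, since its image one step later is a basis
    -- vector and thus nonzero.
    rcases ih (by omega) h1 y with h0 | ⟨⟨z', hz''⟩, -⟩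
    · rw [h0, map_zero, ← hw] at hy
      exact absurd hy.symm ((hβ _).1.ne_zero w)
    · rw [← hz''] at hy
      rw [← hz, ← hz'', hz' z' hy]

/-- Bases that give an interval decomposition yield an isomorphism with a sum of intervals. -/
lemma IsIntervalBasis.hasIntervalDecomposition [Nontrivial R] {ι : Fin (m + 1) → Type}
    {β : ∀ i, ι i → f.obj i} (h : IsIntervalBasis f β)
    (hm : Subsingleton (f.obj (Fin.last m))) : HasIntervalDecomposition f := by
  classical
  obtain ⟨hβ, hmap⟩ := h
  have hmap : ∀ {i j : Fin (m + 1)} (h : i ≤ j) (x : ι i), structureMap f h (β i x) = 0 ∨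
      (structureMap f h (β i x) ∈ Set.range (β j) ∧
      ∀ y : ι i, structureMap f h (β i y) = structureMap f h (β i x) → y = x) := fun h x =>
    hmap _ _ h x
  have hdeath : ∀ (i : Fin (m + 1)) (x : ι i), ∃ d, i < d ∧ ∀ j (h : i ≤ j),
      structureMap f h (β i x) = 0 ↔ d ≤ j := by
    intro i x
    -- The death of a basis vector is the first index at which it vanishes; it exists because f_m =
    -- 0.
    let S : Set (Fin (m + 1)) := {j | ∃ h : i ≤ j, structureMap f h (β i x) = 0}
    have hS : S.Nonempty := ⟨Fin.last m, Fin.le_last i, Subsingleton.elim _ _⟩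
    obtain ⟨hd, h0⟩ : wellFounded_lt.min S hS ∈ S := wellFounded_lt.min_mem S hS
    refine ⟨wellFounded_lt.min S hS, lt_of_le_of_ne hd fun he => ?_, fun j hj => ⟨fun h => ?_,
      fun h => ?_⟩⟩
    · have h1 : ∀ j (h : i ≤ j), i = j → structureMap f h (β i x) ≠ 0 := by
        rintro j h rfl
        rw [structureMap_refl]
        exact (hβ i).1.ne_zero x
      exact h1 _ hd he h0
    · exact not_lt.1 (wellFounded_lt.not_lt_min S ⟨hj, h⟩)
    · rw [← structureMap_trans hd h, h0, map_zero]
  choose death hlt hzero using hdeath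
  -- The intervals are indexed by the basis vectors that are not images of earlier ones, each living
  -- from its own index to its death.
  let gen := {p : Σ i, ι i // ∀ (l : Fin (m + 1)) (h : l < p.1) (y : ι l),
    structureMap f h.le (β l y) ≠ β p.1 p.2}
  let b : gen → Fin (m + 1) := fun p => p.1.1
  let d : gen → Fin (m + 1) := fun p => death p.1.1 p.1.2
  let v : gen → ∀ i, f.obj i := fun p i =>
    if h : p.1.1 ≤ i then structureMap f h (β p.1.1 p.1.2) else 0
  have hv : ∀ (p : gen) (i : Fin (m + 1)) (h : b p ≤ i),
      v p i = structureMap f h (β p.1.1 p.1.2) := fun p i h => dif_pos h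
  have hv_dead : ∀ (p : gen) (i : Fin (m + 1)), ¬ (b p ≤ i ∧ i < d p) → v p i = 0 := by
    intro p i hp
    by_cases h : b p ≤ i
    · rw [hv p i h]
      exact (hzero _ _ _ h).2 (not_lt.1 fun h' => hp ⟨h, h'⟩)
    · exact dif_neg h
  have hv_map : ∀ (p : gen) {i j : Fin (m + 1)} (h : i ≤ j),
      structureMap f h (v p i) = if b p ≤ i then v p j else 0 := by
    intro p i j h
    split_ifs with hb
    · rw [hv p i hb, hv p j (hb.trans h), structureMap_trans]
    · rw [show v p i = 0 from dif_neg hb, map_zero]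
  have hchoice : ∀ i (p : {p : gen // b p ≤ i ∧ i < d p}), ∃ y, β i y = v p.1 i := by
    rintro i ⟨p, hb, hd⟩
    rw [hv p i hb]
    exact ((hmap hb p.1.2).resolve_left fun h => not_le.2 hd ((hzero _ _ _ hb).1 h)).1
  choose φ hφ using hchoice
  have hinj : ∀ i, Function.Injective (φ i) := by
    intro i
    -- By the one-to-one condition at `b q`, the older generator passes through the younger one.
    -- This contradicts the choice of generators unless both are born together.
    have key : ∀ p q : {p : gen // b p ≤ i ∧ i < d p}, b p.1 ≤ b q.1 → v p.1 i = v q.1 i →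
        p = q := by
      rintro ⟨⟨⟨i₁, x⟩, hp⟩, hb₁, hd₁⟩ ⟨⟨⟨i₂, y⟩, hq⟩, hb₂, hd₂⟩ hle he
      change i₁ ≤ i₂ at hle
      change i₁ ≤ i at hb₁
      change i₂ ≤ i at hb₂
      rw [hv _ i hb₁, hv _ i hb₂] at he
      change structureMap f hb₁ (β i₁ x) = structureMap f hb₂ (β i₂ y) at he
      have hne : structureMap f hb₂ (β i₂ y) ≠ 0 := fun h => not_le.2 hd₂ ((hzero _ _ _ hb₂).1 h)
      rw [← structureMap_trans hle hb₂] at he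
      rcases hmap hle x with h0 | ⟨⟨z, hz⟩, -⟩
      · rw [h0, map_zero] at he
        exact absurd he.symm hne
      rw [← hz] at he
      obtain rfl := ((hmap hb₂ y).resolve_left hne).2 z he
      rcases hle.lt_or_eq with hlt | rfl
      · exact absurd hz.symm (hq i₁ hlt x)
      · rw [structureMap_refl] at hz
        obtain rfl := (hβ _).1.injective hz
        rfl
    intro p q hpq
    have he : v p.1 i = v q.1 i := by rw [← hφ, ← hφ, hpq]
    rcases le_total (b p.1) (b q.1) with h | h
    · exact key p q h he
    · exact (key q p h he.symm).symm
  have hsurj : ∀ i, Function.Surjective (φ i) := by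
    intro i y
    -- Tracing `β i y` back to the earliest index from which it comes yields a generator.
    let S : Set (Fin (m + 1)) := {l | ∃ (h : l ≤ i) (x : ι l), structureMap f h (β l x) = β i y}
    have hS : S.Nonempty := ⟨i, le_rfl, y, structureMap_refl _ _⟩
    obtain ⟨hl, x, hx⟩ : wellFounded_lt.min S hS ∈ S := wellFounded_lt.min_mem S hS
    let p : gen := ⟨⟨_, x⟩, fun l h z hz => wellFounded_lt.not_lt_min S
      (x := l) ⟨h.le.trans hl, z, by rw [← structureMap_trans h.le hl, hz, hx]⟩ h⟩
    have hd : i < d p := not_le.1 fun h => (hβ i).1.ne_zero y (by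
      rw [← hx]
      exact (hzero _ _ _ hl).2 h)
    refine ⟨⟨p, hl, hd⟩, (hβ i).1.injective ?_⟩
    rw [hφ, hv p i hl, ← hx]
  let B : ∀ i, Module.Basis {p : gen // b p ≤ i ∧ i < d p} R (f.obj i) := fun i =>
    (Module.Basis.mk (hβ i).1 (hβ i).2.ge).reindex (Equiv.ofBijective _ ⟨hinj i, hsurj i⟩).symm
  have hB : ∀ i p, B i p = v p.1 i := fun i p => by
    simp only [B, Module.Basis.reindex_apply, Equiv.symm_symm, Module.Basis.mk_apply]
    exact hφ i p
  let Φ : ∀ i, (DirectSum gen fun p => intervalSpace R (b p) (d p) i) →ₗ[R] f.obj i := fun i =>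
    DirectSum.toModule R gen _ fun p =>
      (LinearMap.toSpanSingleton R _ (v p i)) ∘ₗ (intervalSpace R (b p) (d p) i).subtype
  have hΦ : ∀ i p (y : intervalSpace R (b p) (d p) i),
      Φ i (DirectSum.lof R gen _ p y) = (y : R) • v p i := fun i p y => by
    simp only [Φ, DirectSum.toModule_lof, LinearMap.comp_apply, LinearMap.toSpanSingleton_apply,
      Submodule.subtype_apply]
  let Ψ : ∀ i, f.obj i →ₗ[R] (DirectSum gen fun p => intervalSpace R (b p) (d p) i) := fun i =>
    (B i).constr R fun p => DirectSum.lof R gen (fun p => intervalSpace R (b p) (d p) i) p.1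
      ⟨1, by rw [intervalSpace, if_pos p.2]; trivial⟩
  have hΨ : ∀ i (p : {p : gen // b p ≤ i ∧ i < d p}), Ψ i (v p.1 i) =
      DirectSum.lof R gen (fun p => intervalSpace R (b p) (d p) i) p.1
      ⟨1, by rw [intervalSpace, if_pos p.2]; trivial⟩ := fun i p => by
    rw [← hB, Module.Basis.constr_basis]
  have h1 : ∀ i, Φ i ∘ₗ Ψ i = LinearMap.id := fun i => (B i).ext fun p => by
    rw [LinearMap.comp_apply, hB, hΨ, hΦ, one_smul]
    rfl
  have h2 : ∀ i, Ψ i ∘ₗ Φ i = LinearMap.id := fun i => DirectSum.linearMap_ext R fun p =>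
    LinearMap.ext fun y => by
      rw [LinearMap.comp_apply, LinearMap.comp_apply, hΦ, map_smul]
      by_cases hp : b p ≤ i ∧ i < d p
      · rw [hΨ i ⟨p, hp⟩, ← map_smul, LinearMap.comp_apply, LinearMap.id_apply]
        congr 1
        exact Subtype.ext (mul_one _)
      · have hy : y = 0 := Subtype.ext (intervalSpace_eq_zero hp y)
        rw [hy]
        simp
  refine ⟨gen, b, d, fun p => hlt _ _, ⟨(NatIso.ofComponents (fun i =>
    (LinearEquiv.ofLinearMap (Φ i) (Ψ i) (h1 i) (h2 i)).toModuleIso) ?_).symm⟩⟩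
  intro i j g
  have hij := leOfHom g
  have hnat : ∀ p (y : intervalSpace R (b p) (d p) i),
      Φ j (DirectSum.lmap (fun p => intervalMap R (b p) (d p) hij) (DirectSum.lof R gen
        (fun p => intervalSpace R (b p) (d p) i) p y)) = structureMap f hij (Φ i
        (DirectSum.lof R gen (fun p => intervalSpace R (b p) (d p) i) p y)) := by
    intro p y
    rw [DirectSum.lmap_lof, hΦ, hΦ, map_smul, hv_map, intervalMap_coe]
    by_cases hb : b p ≤ i
    · by_cases hd : j < d p
      · simp [hb, hd]
      · simp [hd, hb, hv_dead p j fun h => hd h.2]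
    · simp [hb]
  exact ModuleCat.hom_ext (DirectSum.linearMap_ext R fun p => LinearMap.ext fun y => hnat p y)

/-- In a persistence module with an interval decomposition, the submodule
`Ker[i, j-1] + f(i-1 ≤ i) Ker[i-1, j]` of `Ker[i, j]` is saturated. -/
lemma HasIntervalDecomposition.exists_eq_add [IsDomain R] (h : HasIntervalDecomposition f)
    {i₀ i₁ j₁ j₂ : Fin (m + 1)} (hi : i₀ ≤ i₁) (hij : i₁ ≤ j₁) (hj : j₁ ≤ j₂)
    (hi' : ∀ b, b ≤ i₁ → b ≤ i₀ ∨ b = i₁)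
    {π : R} (hπ : π ≠ 0) {x u : f.obj i₁} {w : f.obj i₀}
    (hx : structureMap f (hij.trans hj) x = 0) (hu : structureMap f hij u = 0)
    (hw : structureMap f (hi.trans (hij.trans hj)) w = 0)
    (he : π • x = u + structureMap f hi w) :
    ∃ (u' : f.obj i₁) (w' : f.obj i₀), structureMap f hij u' = 0 ∧
      structureMap f (hi.trans (hij.trans hj)) w' = 0 ∧ x = u' + structureMap f hi w' := by
  classical
  obtain ⟨ι, b, d, -, ⟨e⟩⟩ := h
  set g := persistenceSum fun k => intervalModule R (b k) (d k) with hg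
  let E : ∀ i, f.obj i ≃ₗ[R] DirectSum ι fun k => intervalSpace R (b k) (d k) i := fun i =>
    (e.app i).toLinearEquiv
  have hnat : ∀ {i j : Fin (m + 1)} (h : i ≤ j) (y : f.obj i) (k : ι),
      ((E j (structureMap f h y) k : intervalSpace R (b k) (d k) j) : R)
        = if b k ≤ i ∧ j < d k then ((E i y k : intervalSpace R (b k) (d k) i) : R) else 0 := by
    intro i j h y k
    rw [← intervalMap_coe (b k) (d k) h]
    have : E j (structureMap f h y)
        = DirectSum.lmap (fun k => intervalMap R (b k) (d k) h) (E i y) :=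
      NatTrans.naturality_apply e.hom (homOfLE h) y
    rw [this]
    rfl
  have hext : ∀ {i : Fin (m + 1)} {y z : f.obj i},
      (∀ k, ((E i y k : intervalSpace R (b k) (d k) i) : R) = (E i z k : intervalSpace _ _ _ _)) →
      y = z := fun h => (E _).injective (DFinsupp.ext fun k => Subtype.ext (h k))
  have hker : ∀ {i j : Fin (m + 1)} (h : i ≤ j) (y : f.obj i), structureMap f h y = 0 ↔
      ∀ k, b k ≤ i → j < d k → ((E i y k : intervalSpace R (b k) (d k) i) : R) = 0 := by
    intro i j h y
    constructor
    · intro h0 k hb hd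
      have := hnat h y k
      rw [h0, map_zero, if_pos ⟨hb, hd⟩] at this
      exact this.symm
    · intro h0
      refine hext fun k => ?_
      rw [hnat, map_zero]
      split_ifs with hk
      · exact h0 k hk.1 hk.2
      · rfl
  -- The witness `w'` keeps those coordinates of `x` whose interval is born by `i₀` and alive at
  -- `j₁`. They lift back to `i₀` unchanged, and removing them should leave an element of the kernel
  -- at `j₁`.
  let ρ : ∀ k, intervalSpace R (b k) (d k) i₁ →ₗ[R] intervalSpace R (b k) (d k) i₀ := fun k =>
    if hk : b k ≤ i₀ ∧ j₁ < d k then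
      LinearMap.codRestrict _ (intervalSpace R (b k) (d k) i₁).subtype fun y => by
        rw [intervalSpace, if_pos ⟨hk.1, lt_of_le_of_lt (hi.trans hij) hk.2⟩]
        trivial
    else 0
  have hρ : ∀ k y, ((ρ k y : intervalSpace R (b k) (d k) i₀) : R)
      = if b k ≤ i₀ ∧ j₁ < d k then (y : R) else 0 := by
    intro k y
    by_cases hk : b k ≤ i₀ ∧ j₁ < d k
    · simp only [ρ, hk, and_self, dite_true, if_true]
      rfl
    · simp [ρ, hk]
  let w' : f.obj i₀ := (E i₀).symm (DirectSum.lmap ρ (E i₁ x))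
  have hw' : ∀ k, ((E i₀ w' k : intervalSpace R (b k) (d k) i₀) : R)
      = if b k ≤ i₀ ∧ j₁ < d k then ((E i₁ x k : intervalSpace R (b k) (d k) i₁) : R) else 0 := by
    intro k
    rw [← hρ]
    simp only [w', LinearEquiv.apply_symm_apply]
    rfl
  refine ⟨x - structureMap f hi w', w', ?_, ?_, (sub_add_cancel _ _).symm⟩
  · rw [hker]
    intro k hb hd
    rw [map_sub]
    change ((E i₁ x k : intervalSpace R (b k) (d k) i₁) : R)
      - (E i₁ (structureMap f hi w') k : intervalSpace R (b k) (d k) i₁) = 0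
    rw [hnat, hw']
    rcases hi' _ hb with hb' | hb'
    · rw [if_pos ⟨hb', lt_of_le_of_lt hij hd⟩, if_pos ⟨hb', hd⟩, sub_self]
    -- An interval born at `i₁` receives nothing from `i₀`. If it is alive at `j₁`, its coordinate
    -- in `u` vanishes too, so `π` times the coordinate of `x` is zero.
    have hb₀ : i₀ < i₁ → ¬ b k ≤ i₀ := fun h => hb' ▸ not_le.2 h
    rcases hi.lt_or_eq with hlt | rfl
    · rw [if_neg fun h => hb₀ hlt h.1, sub_zero]
      have h1 := (hker _ _).1 hu k hb hd
      have h2 : ((E i₁ (π • x) k : intervalSpace R (b k) (d k) i₁) : R) = 0 := by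
        rw [he, map_add]
        change ((E i₁ u k : intervalSpace R (b k) (d k) i₁) : R)
          + (E i₁ (structureMap f hi w) k : intervalSpace R (b k) (d k) i₁) = 0
        rw [h1, hnat, if_neg fun h => hb₀ hlt h.1, add_zero]
      rw [map_smul] at h2
      exact (mul_eq_zero.1 h2).resolve_left hπ
    · rw [if_pos ⟨hb, lt_of_le_of_lt hij hd⟩, if_pos ⟨hb, hd⟩, sub_self]
  · rw [hker]
    intro k hb hd
    rw [hw']
    split_ifs with hk
    · exact (hker _ _).1 hx k (hb.trans hi) hd
    · rfl

end Decompositions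

/-! ### Transfer between matrices and structure maps; the main theorem -/

section Bridge

open Matrix

variable {R : Type u} [CommRing R] {m : ℕ}

namespace MatrixModule

section Represents

variable {F : MatrixModule R m} {f : Fin (m + 1) ⥤ ModuleCat.{u} R}
  {e : ∀ i : Fin (m + 1), Module.Basis (Fin (F.dim i)) R (f.obj i)}

lemma Represents.equivFun_succ (h : F.Represents f e) {i : ℕ} (hi : i < m)
    (v : f.obj ⟨i, by omega⟩) :
    (e ⟨i + 1, by omega⟩).equivFun (structureMapSucc f hi v)
      = F.mat i *ᵥ (e ⟨i, by omega⟩).equivFun v := by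
  rw [← h i hi]
  exact (LinearMap.toMatrix_mulVec_repr (e ⟨i, by omega⟩) (e ⟨i + 1, by omega⟩) _ v).symm

lemma Represents.structureMap_eq_zero_iff_of_add_eq (h : F.Represents f e) :
    ∀ (n : ℕ) {i j : Fin (m + 1)} (hle : i ≤ j) (_ : (i : ℕ) + n = j) (v : f.obj i),
      structureMap f hle v = 0 ↔ (e i).equivFun v ∈ F.ker i j
  | 0, i, j, hle, hn, v => by
    obtain rfl : i = j := Fin.ext hn
    rw [F.ker_of_le le_rfl, Submodule.mem_bot, LinearEquiv.map_eq_zero_iff, structureMap_refl]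
  | n + 1, ⟨i, hi⟩, j, hle, hn, v => by
    have hn' : i + 1 + n = j := by rw [← hn]; simp only; omega
    have hle' : (⟨i + 1, by omega⟩ : Fin (m + 1)) ≤ j := Fin.mk_le_of_le_val (by omega)
    rw [F.mem_ker_succ (by simp only; omega), ← h.equivFun_succ (by omega),
      ← h.structureMap_eq_zero_iff_of_add_eq n hle' hn', structureMap_trans]

lemma Represents.structureMap_eq_zero_iff (h : F.Represents f e) {i j : Fin (m + 1)} (hle : i ≤ j)
    (v : f.obj i) : structureMap f hle v = 0 ↔ (e i).equivFun v ∈ F.ker i j :=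
  h.structureMap_eq_zero_iff_of_add_eq (j - i) hle (Nat.add_sub_cancel' hle) v

/-- Certificates are sound. -/
lemma Certificate.Valid.not_hasIntervalDecomposition [IsDomain R] (h : F.Represents f e)
    {c : F.Certificate} (hc : c.Valid) : ¬ HasIntervalDecomposition f := by
  intro hf
  obtain ⟨hkm, hkj, hX, hY, ⟨Z, hZ, hA⟩, a, ha⟩ := hc
  obtain ⟨k, j, X, Y, A, fac⟩ := c
  dsimp only at hkm hkj hX hY Z hZ hA a ha
  have hmul := mat_mulVec_sub_mem hX hZ hY j hkj
  rw [← hA] at hmul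
  have hX' := hX.isGradedBasis j (by omega)
  have hY' := hY.isGradedBasis j (by omega)
  -- With `t` and `S s` the unit vectors at `a`, the factorization reads `A T t = α_a s`: the class
  -- of `X^j s` becomes an image after multiplication by `α_a`.
  let t : Fin (Y j).width → R := Pi.single (Fin.castLE fac.rank_le_cols a) 1
  obtain ⟨S', hS'⟩ := fac.isUnit_S.exists_right_inv
  let s : Fin (X j).width → R := S' *ᵥ Pi.single (Fin.castLE fac.rank_le_rows a) 1
  have hs : fac.S *ᵥ s = Pi.single (Fin.castLE fac.rank_le_rows a) 1 := by
    rw [Matrix.mulVec_mulVec, hS', Matrix.one_mulVec]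
  have hAt : A *ᵥ (fac.T *ᵥ t) = fac.elem a • s := by
    refine fac.mulVec_S_injective ?_
    rw [fac.S_mulVec, Matrix.mulVec_smul, hs]
    ext x
    rw [rectDiagonal_mulVec fac.rank_le_cols]
    by_cases hx : x = Fin.castLE fac.rank_le_rows a
    · subst hx
      have ha' : (Fin.castLE fac.rank_le_rows a : ℕ) < fac.rank := a.2
      rw [dif_pos ha']
      simp only [t, Pi.smul_apply, Pi.single_eq_same, smul_eq_mul]
      congr 1
      exact Pi.single_eq_same (M := fun _ => R) _ _
    · rw [Pi.smul_apply, Pi.single_eq_of_ne hx, smul_zero]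
      split_ifs with hx'
      · have hne : (⟨x, hx'.trans_le fac.rank_le_cols⟩ : Fin (Y j).width)
            ≠ Fin.castLE fac.rank_le_cols a := fun h => hx (Fin.ext (Fin.mk.inj h))
        exact (congrArg _ (Pi.single_eq_of_ne hne 1)).trans (mul_zero _)
      · rfl
  let i₀ : Fin (m + 1) := ⟨k, by omega⟩
  let i₁ : Fin (m + 1) := ⟨k + 1, by omega⟩
  let j₁ : Fin (m + 1) := ⟨j - 1, by omega⟩
  have hi : i₀ ≤ i₁ := Fin.mk_le_mk.2 (by omega)
  have hij : i₁ ≤ j₁ := Fin.mk_le_mk.2 (by omega)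
  have hj : j₁ ≤ j := Fin.mk_le_of_le_val (by omega)
  let x : f.obj i₁ := (e i₁).equivFun.symm ((X j).mat *ᵥ s)
  let w : f.obj i₀ := (e i₀).equivFun.symm ((Y j).mat *ᵥ (fac.T *ᵥ t))
  have hx : (e i₁).equivFun x = (X j).mat *ᵥ s := LinearEquiv.apply_symm_apply _ _
  have hw : (e i₀).equivFun w = (Y j).mat *ᵥ (fac.T *ᵥ t) := LinearEquiv.apply_symm_apply _ _
  have hnext : ∀ y : f.obj i₀, (e i₁).equivFun (structureMap f hi y)
      = F.mat k *ᵥ (e i₀).equivFun y := fun y => h.equivFun_succ (by omega) y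
  obtain ⟨u', w', hu', hw', he⟩ := hf.exists_eq_add hi hij hj (fun b hb => by
      have h1 : (b : ℕ) ≤ k + 1 := hb
      rcases Nat.le_succ_iff.1 h1 with h2 | h2
      · exact Or.inl h2
      · exact Or.inr (Fin.ext h2)) (fac.elem_ne_zero a) (x := x)
    (u := fac.elem a • x - structureMap f hi w) (w := w)
    (by
      rw [h.structureMap_eq_zero_iff, hx]
      exact hX'.mem s)
    (by
      rw [h.structureMap_eq_zero_iff, map_sub, map_smul, hx, hnext, hw, ← Matrix.mulVec_smul,
        ← hAt, ← neg_sub]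
      exact Submodule.neg_mem _ (hmul _))
    (by
      rw [h.structureMap_eq_zero_iff, hw]
      exact hY'.mem _)
    (sub_add_cancel _ _).symm
  rw [h.structureMap_eq_zero_iff] at hu' hw'
  have he := congrArg (e i₁).equivFun he
  rw [hx, map_add, hnext] at he
  obtain ⟨q, hq⟩ := hY'.exists_sub_mem _ hw'
  have hq' := (F.mem_ker_succ (show k + 1 ≤ (j : ℕ) - 1 by omega)).1 hq
  -- Saturation puts `X^j s` itself into the image modulo Ker[k+1,j-1], that is, `s = A q`.
  -- Comparing coordinate `a` after applying `S` gives `1` as a multiple of `α_a`.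
  have hsq : s - A *ᵥ q = 0 := by
    refine hX'.eq_zero _ ?_
    have := Submodule.add_mem _ (Submodule.add_mem _ hu' hq') (hmul q)
    rw [Matrix.mulVec_sub, he]
    convert this using 1
    rw [Matrix.mulVec_sub]
    abel
  obtain ⟨q, rfl⟩ := fac.mulVec_T_bijective.2 q
  rw [sub_eq_zero] at hsq
  rw [hsq, fac.S_mulVec] at hs
  have hone := congrFun hs (Fin.castLE fac.rank_le_rows a)
  have ha' : (Fin.castLE fac.rank_le_rows a : ℕ) < fac.rank := a.2
  rw [rectDiagonal_mulVec fac.rank_le_cols, dif_pos ha', Pi.single_eq_same] at hone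
  exact ha (IsUnit.of_mul_eq_one _ hone)

/-- The columns of the computed partitioned matrices are bases that give an interval
decomposition. -/
lemma IsPartialSolution.isIntervalBasis [Nontrivial R] (h : F.Represents f e)
    {Y : ∀ i : ℕ, BlockRow R (F.dim i)} (hY : F.IsPartialSolution (m - 1) Y) :
    IsIntervalBasis f (F.columnVectors e Y) := by
  have hker : ∀ i ≤ m, F.IsKernelFiltration i (Y i) := fun i hi => by
    rcases le_or_gt i (m - 1) with h' | h'
    · exact hY.isKernelFiltration i h'
    · rw [hY.eq_empty i h']
      exact isKernelFiltration_empty (by omega)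
  have hcol : ∀ (i : Fin (m + 1)) s, F.columnVectors e Y i s
      = (e i).equivFun.symm fun x => (Y i s.1).mat x s.2 := fun i s => by
    rw [Module.Basis.equivFun_symm_apply]
    rfl
  have hfun : ∀ i : Fin (m + 1), F.columnVectors e Y i
      = (e i).equivFun.symm ∘ ((Y i).toMatrix m).col ∘ (Y i).colEquiv m := fun i => by
    ext s
    rw [hcol, Function.comp_apply, Function.comp_apply]
    congr 1
    ext x
    exact ((Y i).toMatrix_apply m x s).symm
  have hbasis : ∀ i : Fin (m + 1), LinearIndependent R (F.columnVectors e Y i) ∧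
      Submodule.span R (Set.range (F.columnVectors e Y i)) = ⊤ := fun i => by
    obtain ⟨⟨Z, hZ₁, hZ₂⟩, -⟩ := hker i (by omega)
    rw [hfun i]
    constructor
    · refine LinearIndependent.map' (LinearIndependent.comp ?_ _ ((Y i).colEquiv m).injective)
        (e i).equivFun.symm.toLinearMap (LinearEquiv.ker _)
      refine Matrix.mulVec_injective_iff.1 fun x y hxy => ?_
      have := congrArg (Z *ᵥ ·) hxy
      simpa only [Matrix.mulVec_mulVec, hZ₁, Matrix.one_mulVec] using this
    · rw [Set.range_comp, ((Y i).colEquiv m).surjective.range_comp]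
      have hspan := Submodule.span_image (e i).equivFun.symm.toLinearMap
        (s := Set.range ((Y i).toMatrix m).col)
      rw [← Matrix.range_mulVecLin, LinearMap.range_eq_top.2 fun x => ⟨Z *ᵥ x, by
        rw [Matrix.mulVecLin_apply, Matrix.mulVec_mulVec, hZ₂, Matrix.one_mulVec]⟩,
        Submodule.map_top, LinearEquiv.range] at hspan
      exact hspan
  refine isIntervalBasis_of_succ hbasis fun i hi x => ?_
  let i₀ : Fin (m + 1) := ⟨i, by omega⟩
  let i₁ : Fin (m + 1) := ⟨i + 1, by omega⟩
  have hnext : ∀ y, (e i₁).equivFun (structureMapSucc f hi (F.columnVectors e Y i₀ y))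
      = F.mat i *ᵥ fun x => (Y i y.1).mat x y.2 := fun y => by
    rw [hcol, h.equivFun_succ hi]
    exact congrArg _ (LinearEquiv.apply_symm_apply _ _)
  -- A column in a block up to `i + 1` lies in Ker[i,i+1]. For `i + 1 = m` the target is zero; this
  -- case is separate because extensions are only known up to index `m - 1`.
  have hzero : ∀ y : Σ j : Fin (m + 1), Fin (Y i j).width, (y.1 : ℕ) ≤ i + 1 ∨ i + 1 = m →
      structureMapSucc f hi (F.columnVectors e Y i₀ y) = 0 := fun y hy => by
    rw [← LinearEquiv.map_eq_zero_iff (e i₁).equivFun, hnext]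
    rcases hy with hy | hy
    · have h1 := ((hker i hi.le).isGradedBasis y.1 (by omega)).mem (Pi.single y.2 1)
      rw [Matrix.mulVec_single_one] at h1
      have h2 := F.ker_mono i hy h1
      rwa [F.mem_ker_succ le_rfl, F.ker_of_le le_rfl, Submodule.mem_bot] at h2
    · ext z
      exact (Fin.cast (F.dim_of_ge (i + 1) hy.ge) z).elim0
  by_cases hx : (x.1 : ℕ) ≤ i + 1 ∨ i + 1 = m
  · exact Or.inl (hzero x hx)
  push Not at hx
  right
  have hext : ∀ l : Fin (m + 1), i + 1 < l → F.IsExtension i (Y i l) (Y (i + 1) l) := fun l hl =>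
    hY.isExtension i (by omega) l (by omega) hl
  have himage : ∀ (l : Fin (m + 1)) (hl : i + 1 < l) (a : Fin (Y i l).width),
      structureMapSucc f hi (F.columnVectors e Y i₀ ⟨l, a⟩)
        = F.columnVectors e Y i₁ ⟨l, (hext l hl).choose a⟩ := fun l hl a => by
    apply (e i₁).equivFun.injective
    rw [hnext, hcol, LinearEquiv.apply_symm_apply]
    exact ((hext l hl).choose_spec.2 a).symm
  obtain ⟨l, a⟩ := x
  rw [himage l hx.1 a]
  refine ⟨⟨_, rfl⟩, ?_⟩
  rintro ⟨l', a'⟩ hy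
  by_cases hl' : (l' : ℕ) ≤ i + 1
  · rw [hzero ⟨l', a'⟩ (Or.inl hl')] at hy
    exact absurd hy.symm ((hbasis i₁).1.ne_zero _)
  rw [himage l' (not_le.1 hl') a'] at hy
  have := (hbasis i₁).1.injective hy
  rw [Sigma.mk.injEq] at this
  obtain ⟨rfl, h2⟩ := this
  rw [(hext l' hx.1).choose_spec.1 (eq_of_heq h2)]

end Represents

/-- Persistence modules of finitely generated free modules are given by matrices. -/
lemma exists_represents [Nontrivial R] (f : Fin (m + 1) ⥤ ModuleCat.{u} R)
    (hfree : ∀ i, Module.Free R (f.obj i)) (hfin : ∀ i, Module.Finite R (f.obj i))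
    (h0 : Subsingleton (f.obj 0)) (hm : Subsingleton (f.obj (Fin.last m))) :
    ∃ (F : MatrixModule R m)
      (e : ∀ i : Fin (m + 1), Module.Basis (Fin (F.dim i)) R (f.obj i)), F.Represents f e := by
  let dim : ℕ → ℕ := fun i =>
    if h : i < m + 1 then Module.finrank R (f.obj ⟨i, h⟩) else 0
  have hdim : ∀ i : Fin (m + 1), Module.finrank R (f.obj i) = dim i := fun i =>
    (dif_pos i.2 : dim i = _).symm
  let e : ∀ i : Fin (m + 1), Module.Basis (Fin (dim i)) R (f.obj i) := fun i =>
    Module.finBasisOfFinrankEq R (f.obj i) (hdim i)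
  refine ⟨⟨dim, fun i => if hi : i < m then LinearMap.toMatrix (e ⟨i, by omega⟩)
    (e ⟨i + 1, by omega⟩) (structureMapSucc f hi) else 0, ?_, fun i hi => ?_⟩, e, fun i hi => ?_⟩
  · rw [← Fin.val_zero (m + 1), ← hdim]
    exact Module.finrank_zero_of_subsingleton
  · rcases hi.lt_or_eq with hi | rfl
    · exact dif_neg (by omega)
    · rw [← Fin.val_last m, ← hdim]
      exact Module.finrank_zero_of_subsingleton
  · dsimp only
    rw [dif_pos hi]

end MatrixModule

end Bridge

theorem theorem1p2 {R : Type u} [CommRing R] [IsDomain R] [IsPrincipalIdealRing R] :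
    -- every pointwise free and finitely generated `f` with `f_0 = f_m = 0` is given by matrices
    (∀ (m : ℕ) (f : Fin (m + 1) ⥤ ModuleCat.{u} R),
      (∀ i, Module.Free R (f.obj i)) → (∀ i, Module.Finite R (f.obj i)) →
      Subsingleton (f.obj 0) → Subsingleton (f.obj (Fin.last m)) →
      ∃ (F : MatrixModule R m)
        (e : ∀ i : Fin (m + 1), Module.Basis (Fin (F.dim i)) R (f.obj i)), F.Represents f e) ∧
    -- correctness of the algorithm, soundness of certificates, and termination
    (∀ (proc : MatrixProcedures R) (m : ℕ) (f : Fin (m + 1) ⥤ ModuleCat.{u} R)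
      (F : MatrixModule R m) (e : ∀ i : Fin (m + 1), Module.Basis (Fin (F.dim i)) R (f.obj i)),
      F.Represents f e →
      (∀ out : F.Output, (MatrixModule.algorithm proc F).Returns out →
        (HasIntervalDecomposition f →
          ∃ Y, out = MatrixModule.Output.bases Y ∧ IsIntervalBasis f (F.columnVectors e Y)) ∧
        (¬ HasIntervalDecomposition f →
          ∃ c, out = MatrixModule.Output.halt c ∧ c.Valid)) ∧
      (∀ c : F.Certificate, c.Valid → ¬ HasIntervalDecomposition f) ∧
      (proc.FiniteTime → (MatrixModule.algorithm proc F).Halts)) ∧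
    -- polynomial time in the length `m` and the largest rank
    (∀ P : Polynomial ℕ, ∃ Q : Polynomial ℕ, ∀ proc : MatrixProcedures R, proc.TimeBoundedBy P →
      ∀ (m d : ℕ) (F : MatrixModule R m), (∀ i, F.dim i ≤ d) →
        (MatrixModule.algorithm proc F).HaltsWithin (Q.eval (m + d))) := by
  refine ⟨fun m f hfree hfin h0 hm => MatrixModule.exists_represents f hfree hfin h0 hm,
    fun proc m f F e h => ⟨fun out hout => ?_, fun c hc => hc.not_hasIntervalDecomposition h,
      fun hproc => hproc.outerLoop _ _ _ _⟩,
    MatrixModule.algorithm_haltsWithin⟩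
  obtain ⟨hhalt, hbases⟩ := MatrixModule.algorithm_returns hout
  have hm : Subsingleton (f.obj (Fin.last m)) := by
    have : IsEmpty (Fin (F.dim (Fin.last m))) :=
      ⟨fun x => (Fin.cast (F.dim_of_ge _ (by simp)) x).elim0⟩
    exact (e (Fin.last m)).equivFun.toEquiv.subsingleton
  -- Bases prove that a decomposition exists and a certificate refutes it, so each output settles
  -- both implications.
  rcases out with Y | c
  · have hY := (hbases Y rfl).isIntervalBasis h
    exact ⟨fun _ => ⟨Y, rfl, hY⟩, fun hf => absurd (hY.hasIntervalDecomposition hm) hf⟩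
  · have hc := hhalt c rfl
    exact ⟨fun hf => absurd hf (hc.not_hasIntervalDecomposition h), fun _ => ⟨c, rfl, hc⟩⟩
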